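/- Let $(\mathcal V,\otimes,I)$ be a bicomplete symmetric monoidal closed category, and let $F:\mathrm{Set}\to\mathcal V$ send a set $A$ to the coproduct $\coprod_{A} I$. For a set $S$, let $\mathcal V\mathrm{Quiv}_S$ be the category of families $Q=(Q(a,b))_{a,b\in S}$ of objects of $\mathcal V$, with families of morphisms between them. It is monoidal with $(Q\otimes_S P)(a,b)=\coprod_{c\in S}Q(a,c)\otimes P(c,b)$ and unit $I_S$, where $I_S(a,b)=I$ if $a=b$ and $I_S(a,b)=0$ (the initial object) if $a\ne b$. Let $\Delta_f$ be the category of finite intervals: its objects are the posets $[n]=\{0<\dots<n\}$, $n\ge 0$, its morphisms are the order morphisms $f:[m]\to[n]$ with $f(0)=0$ and $f(m)=n$, and it is monoidal with unit $[0]$ and $[m]+[n]=[m+n]$ (glue the top endpoint of $[m]$ to the bottom endpoint of $[n]$). **Templicial objects.** A templicial object $(X,S)$ in $\mathcal V$ is a set $S$ with a colax monoidal functor $X:\Delta_f^{op}\to\mathcal V\mathrm{Quiv}_S$, $[n]\mapsto X_n$, whose counit $X_0\to I_S$ is an isomorphism. For $n\ge0$ put $X^{deg}_n=\mathrm{colim}\,X_k$,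 where the colimit runs over the surjective order morphisms $[n]\twoheadrightarrow[k]$ with $k<n$ (and the surjections under $[n]$ between them). One says that $X$ has non-degenerate simplices if for every $n\ge 0$ there is a quiver $X^{nd}_n$ such that the canonical morphism $X^{deg}_n\to X_n$ is isomorphic to the coprojection $X^{deg}_n\to X^{deg}_n\amalg X^{nd}_n$; a choice of the $X^{nd}_n$ is then fixed. **Necklaces.** A necklace is a pair $(T,p)$ with $p\ge0$ and $\{0,p\}\subseteq T\subseteq[p]$; a morphism $(T,p)\to(U,q)$ is a morphism $f:[p]\to[q]$ of $\Delta_f$ with $U\subseteq f(T)$. Let $\mathcal N$ be the category of necklaces. For $T=\{0=t_0<t_1<\dots<t_k=p\}$ set $$X_T=X_{t_1}\otimes_S X_{t_2-t_1}\otimes_S\dots\otimes_S X_{p-t_{k-1}},\qquad X^{nd}_T=X^{nd}_{t_1}\otimes_S X^{nd}_{t_2-t_1}\otimes_S\dots\otimes_S X^{nd}_{p-t_{k-1}},$$ both being $I_S$ if $k=0$. The assignment $T\mapsto X_T$ is a functor $\mathcal N^{op}\to\mathcal V\mathrm{Quiv}_S$: a morphism $f:(T,p)\to(U,q)$ acts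 as the composite $X_U\to X_{f(T)}\to X_T$, where $X_U\to X_{f(T)}$ is given by the comultiplications of $X$, and $X_{f(T)}\to X_T$ is given by the restrictions of $f$ to the intervals between consecutive elements of $T$ (with $I_S\cong X_0$ inserted for each such interval that $f$ maps to a point). **Flags.** For a necklace $(T,p)$ let $\mathcal P_T=\{U\mid T\subseteq U\subseteq[p]\}$, ordered by inclusion; it is functorial in $T$ through $U\mapsto f(U)$. A flag of length $n$ on $T$ is an $n$-simplex of the nerve $N\mathcal P_T$, that is, a sequence $\vec T=(T_0\subseteq T_1\subseteq\dots\subseteq T_n)$ in $\mathcal P_T$. It is flanked if $T_0=T$ and $T_n=[p]$. **Categorification.** For $a,b\in S$ the hom-object $\mathfrak C_{\mathcal V}[X](a,b)$ is the simplicial object of $\mathcal V$ obtained as the colimit of $T\mapsto FN\mathcal P_T$ weighted by $T\mapsto X_T(a,b)$, i.e. the coequaliser $$\coprod_{f:T\to U\text{ in }\mathcal N}X_U(a,b)\otimes FN\mathcal P_T\rightrightarrows\coprod_{T\in\mathcal N}X_T(a,b)\otimes FN\mathcal P_T\to\mathfrak C_{\mathcal V}[X](a,b)$$ of the morphisms induced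 by $X_U(a,b)\to X_T(a,b)$ and by $FN\mathcal P_T\to FN\mathcal P_U$. **Proposition.** Let $(X,S)$ be a templicial object in $\mathcal V$ with non-degenerate simplices. For all $n\ge 0$ and $a,b\in S$ there is an isomorphism in $\mathcal V$ $$\mathfrak C_{\mathcal V}[X]_n(a,b)\;\cong\;\coprod_{\substack{T\in\mathcal N,\\ \vec T\text{ flanked flag on }T\text{ of length }n}}X^{nd}_T(a,b).$$ -/

import Mathlib

open CategoryTheory Limits MonoidalCategory Opposite

universe v u

noncomputable section

namespace Templicial

/-- Objects `[n]` of the category of finite intervals. -/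
@[ext]
structure FinInt where
  len : ℕ

namespace FinInt

@[ext]
structure Hom (m n : FinInt) where
  toOrderHom : Fin (m.len + 1) →o Fin (n.len + 1)
  map_zero : toOrderHom 0 = 0
  map_last : toOrderHom (Fin.last _) = Fin.last _

instance : Category FinInt where
  Hom := Hom
  id m := ⟨OrderHom.id, rfl, rfl⟩
  comp f g := ⟨g.toOrderHom.comp f.toOrderHom, by simp [f.map_zero, g.map_zero],
    by simp [f.map_last, g.map_last]⟩

/-- The underlying map of vertices, extended to all natural numbers by the constant value at
the last vertex. -/
def ev {m n : FinInt} (f : m ⟶ n) (i : ℕ) : ℕ :=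
  (f.toOrderHom ⟨min i m.len, by omega⟩ : ℕ)

variable {l m n k : FinInt}

lemma ev_mono (f : m ⟶ n) : Monotone (ev f) := fun i j h =>
  f.toOrderHom.monotone (by simp only [Fin.mk_le_mk]; omega)

@[simp] lemma ev_zero (f : m ⟶ n) : ev f 0 = 0 := by
  have := congrArg Fin.val f.map_zero
  simpa [ev] using this

lemma ev_of_le (f : m ⟶ n) {i : ℕ} (h : m.len ≤ i) : ev f i = n.len := by
  have := congrArg Fin.val f.map_last
  simpa [ev, Fin.last, min_eq_right h] using this

lemma ev_le (f : m ⟶ n) (i : ℕ) : ev f i ≤ n.len := by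
  unfold ev; omega

lemma ev_fin (f : m ⟶ n) (i : Fin (m.len + 1)) : ev f i = f.toOrderHom i := by
  have h : min (i : ℕ) m.len = i := by omega
  simp [ev, h]

lemma hom_ext {f g : m ⟶ n} (h : ∀ i ≤ m.len, ev f i = ev g i) : f = g := by
  apply Hom.ext
  ext i
  have := h i (by omega)
  rwa [ev_fin, ev_fin] at this

/-- A morphism from a function on natural numbers. -/
def homMk (φ : ℕ → ℕ) (hφ : ∀ i j, i ≤ j → j ≤ m.len → φ i ≤ φ j) (h0 : φ 0 = 0)
    (h1 : φ m.len = n.len) : m ⟶ n where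
  toOrderHom :=
    { toFun i := ⟨φ i, by have := hφ i m.len (by omega) le_rfl; omega⟩
      monotone' i j h := by
        simp only [Fin.mk_le_mk]; exact hφ _ _ h (by omega) }
  map_zero := Fin.ext h0
  map_last := Fin.ext h1

lemma ev_homMk (φ : ℕ → ℕ) (hφ : ∀ i j, i ≤ j → j ≤ m.len → φ i ≤ φ j) (h0 : φ 0 = 0)
    (h1 : φ m.len = n.len) (i : ℕ) : ev (homMk (n := n) φ hφ h0 h1) i = φ (min i m.len) := rfl

lemma ev_id (i : ℕ) : ev (𝟙 m) i = min i m.len := rfl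

lemma ev_comp (f : m ⟶ n) (g : n ⟶ k) (i : ℕ) : ev (f ≫ g) i = ev g (ev f i) := by
  have : ev f i = f.toOrderHom ⟨min i m.len, by omega⟩ := rfl
  rw [this, ev_fin]; rfl

/-- The sum `f + g` of morphisms, gluing the last vertex of the first interval to the first vertex
of the second one. -/
def addHom {m m' n n' : FinInt} (f : m ⟶ m') (g : n ⟶ n') :
    (⟨m.len + n.len⟩ : FinInt) ⟶ ⟨m'.len + n'.len⟩ :=
  homMk (fun i => if i ≤ m.len then ev f i else m'.len + ev g (i - m.len))
    (fun i j hij _ => by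
      have h1 := ev_mono f hij
      have h2 := ev_mono g (show i - m.len ≤ j - m.len by omega)
      have h3 := ev_le f i
      split_ifs <;> omega)
    (by simp)
    (by
      have h1 := ev_of_le f le_rfl
      have h2 := ev_of_le g le_rfl
      have h3 := ev_zero g
      have h5 := fun h => ev_of_le f (i := m.len + n.len) h
      have h4 := fun h => ev_of_le g (i := 0) h
      simp only [Nat.add_sub_cancel_left]
      split_ifs <;> grind)

lemma ev_addHom {m m' n n' : FinInt} (f : m ⟶ m') (g : n ⟶ n') (i : ℕ) :
    ev (addHom f g) i = if i ≤ m.len then ev f i else m'.len + ev g (i - m.len) := by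
  rcases le_total i (m.len + n.len) with h | h
  · refine (ev_homMk _ _ _ _ i).trans ?_
    rw [min_eq_left h]
  · rw [ev_of_le _ h]
    have h2 := fun h => ev_of_le g (i := i - m.len) h
    have h3 := ev_zero g
    have h5 := fun h => ev_of_le f (i := i) h
    have h4 := fun h => ev_of_le g (i := 0) h
    split_ifs <;> grind

/-- Reindexing along an equality of lengths. -/
def castIso {m n : FinInt} (h : m.len = n.len) : m ≅ n where
  hom := homMk id (fun _ _ h _ => h) rfl h
  inv := homMk id (fun _ _ h _ => h) rfl h.symm
  hom_inv_id := hom_ext fun i hi => by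
    simp only [ev_comp, ev_id, ev_homMk, id]; omega
  inv_hom_id := hom_ext fun i hi => by
    simp only [ev_comp, ev_id, ev_homMk, id]; omega

instance : MonoidalCategoryStruct FinInt where
  tensorObj m n := ⟨m.len + n.len⟩
  whiskerLeft m _ _ g := addHom (𝟙 m) g
  whiskerRight f n := addHom f (𝟙 n)
  tensorHom f g := addHom f g
  tensorUnit := ⟨0⟩
  associator _ _ _ := castIso (Nat.add_assoc _ _ _)
  leftUnitor _ := castIso (Nat.zero_add _)
  rightUnitor _ := castIso (Nat.add_zero _)

lemma tensor_len (m n : FinInt) : (m ⊗ n).len = m.len + n.len := rfl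
lemma unit_len : (𝟙_ FinInt).len = 0 := rfl

lemma ev_tensorHom {m m' n n' : FinInt} (f : m ⟶ m') (g : n ⟶ n') (i : ℕ) :
    ev (f ⊗ₘ g) i = if i ≤ m.len then ev f i else m'.len + ev g (i - m.len) :=
  ev_addHom f g i

lemma ev_whiskerRight {m m' : FinInt} (f : m ⟶ m') (n : FinInt) (i : ℕ) :
    ev (f ▷ n) i = if i ≤ m.len then ev f i else m'.len + min (i - m.len) n.len :=
  ev_addHom f (𝟙 n) i

lemma ev_whiskerLeft (m : FinInt) {n n' : FinInt} (g : n ⟶ n') (i : ℕ) :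
    ev (m ◁ g) i = if i ≤ m.len then i else m.len + ev g (i - m.len) := by
  refine (ev_addHom (𝟙 m) g i).trans ?_
  split_ifs with h
  · rw [ev_id, min_eq_left h]
  · rfl

lemma ev_associator_hom (l m n : FinInt) (i : ℕ) :
    ev (α_ l m n).hom i = min i (l.len + m.len + n.len) := rfl
lemma ev_associator_inv (l m n : FinInt) (i : ℕ) :
    ev (α_ l m n).inv i = min i (l.len + (m.len + n.len)) := rfl
lemma ev_leftUnitor_hom (n : FinInt) (i : ℕ) : ev (λ_ n).hom i = min i (0 + n.len) := rfl
lemma ev_leftUnitor_inv (n : FinInt) (i : ℕ) : ev (λ_ n).inv i = min i n.len := rfl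
lemma ev_rightUnitor_hom (n : FinInt) (i : ℕ) : ev (ρ_ n).hom i = min i (n.len + 0) := rfl
lemma ev_rightUnitor_inv (n : FinInt) (i : ℕ) : ev (ρ_ n).inv i = min i n.len := rfl

instance : MonoidalCategory FinInt where
  tensorHom_def f g := hom_ext fun i hi => by
    have h1 := ev_le f i
    have h2 := ev_of_le f (i := i)
    have h3 := ev_zero g
    simp only [ev_comp, ev_tensorHom, ev_whiskerLeft, ev_whiskerRight, tensor_len] at *
    split_ifs <;> grind
  id_tensorHom_id m n := hom_ext fun i hi => by
    simp only [ev_tensorHom, ev_id, tensor_len] at *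
    split_ifs <;> omega
  tensorHom_comp_tensorHom {X₁ Y₁ Z₁ X₂ Y₂ Z₂} f g h k := hom_ext fun i hi => by
    have h1 := ev_le f i
    have h2 := ev_of_le h (i := Y₁.len)
    have h3 := ev_zero k
    simp only [ev_comp, ev_tensorHom, tensor_len] at *
    split_ifs <;> grind
  whiskerLeft_id m n := hom_ext fun i hi => by
    simp only [ev_whiskerLeft, ev_id, tensor_len] at *
    split_ifs <;> omega
  id_whiskerRight m n := hom_ext fun i hi => by
    simp only [ev_whiskerRight, ev_id, tensor_len] at *
    split_ifs <;> omega
  associator_naturality {X₁ X₂ X₃ Y₁ Y₂ Y₃} f g h := hom_ext fun i hi => by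
    have h1 := ev_le f i
    have h2 := ev_le g (i - X₁.len)
    have h3 := ev_le h (i - X₁.len - X₂.len)
    have h4 : i - (X₁.len + X₂.len) = i - X₁.len - X₂.len := by omega
    simp only [ev_comp, ev_tensorHom, ev_associator_hom, tensor_len, h4] at *
    rw [min_eq_left hi]
    split_ifs <;> omega
  leftUnitor_naturality {X Y} f := hom_ext fun i hi => by
    have h1 := ev_le f i
    have h2 := ev_zero f
    simp only [ev_comp, ev_whiskerLeft, ev_leftUnitor_hom, tensor_len, unit_len] at *
    rw [min_eq_left hi]
    split_ifs <;> grind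
  rightUnitor_naturality {X Y} f := hom_ext fun i hi => by
    have h1 := ev_le f i
    simp only [ev_comp, ev_whiskerRight, ev_rightUnitor_hom, tensor_len, unit_len] at *
    rw [min_eq_left hi]
    split_ifs <;> omega
  pentagon k l m n := hom_ext fun i hi => by
    simp only [ev_comp, ev_whiskerRight, ev_whiskerLeft, ev_associator_hom, tensor_len] at *
    split_ifs <;> omega
  triangle m n := hom_ext fun i hi => by
    simp only [ev_comp, ev_whiskerRight, ev_whiskerLeft, ev_associator_hom, ev_leftUnitor_hom,
      ev_rightUnitor_hom, tensor_len, unit_len] at *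
    split_ifs <;> omega

end FinInt

section SigmaTensor

variable {V : Type u} [Category.{v} V] [MonoidalCategory V] [SymmetricCategory V]
  [MonoidalClosed V] [HasColimits V]

instance tensorRight_preserves (R : V) : PreservesColimitsOfSize.{v, v} (tensorRight R) :=
  preservesColimits_of_natIso (BraidedCategory.tensorLeftIsoTensorRight R)

variable {ι : Type v} {F : ι → V} {R Z : V}

/-- Morphisms out of `(∐ F) ⊗ R`. -/
def descRight (φ : ∀ i, F i ⊗ R ⟶ Z) : (∐ F) ⊗ R ⟶ Z :=
  (isColimitCofanMkObjOfIsColimit (tensorRight R) F _ (coproductIsCoproduct F)).desc (Cofan.mk Z φ)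

@[simp] lemma ι_descRight (φ : ∀ i, F i ⊗ R ⟶ Z) (i : ι) :
    Sigma.ι F i ▷ R ≫ descRight φ = φ i :=
  (isColimitCofanMkObjOfIsColimit (tensorRight R) F _ (coproductIsCoproduct F)).fac
    (Cofan.mk Z φ) ⟨i⟩

lemma right_hom_ext {f g : (∐ F) ⊗ R ⟶ Z} (h : ∀ i, Sigma.ι F i ▷ R ≫ f = Sigma.ι F i ▷ R ≫ g) :
    f = g :=
  (isColimitCofanMkObjOfIsColimit (tensorRight R) F _ (coproductIsCoproduct F)).hom_ext
    fun ⟨i⟩ => h i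

/-- Morphisms out of `R ⊗ (∐ F)`. -/
def descLeft (φ : ∀ i, R ⊗ F i ⟶ Z) : R ⊗ (∐ F) ⟶ Z :=
  (isColimitCofanMkObjOfIsColimit (tensorLeft R) F _ (coproductIsCoproduct F)).desc (Cofan.mk Z φ)

@[simp] lemma ι_descLeft (φ : ∀ i, R ⊗ F i ⟶ Z) (i : ι) :
    R ◁ Sigma.ι F i ≫ descLeft φ = φ i :=
  (isColimitCofanMkObjOfIsColimit (tensorLeft R) F _ (coproductIsCoproduct F)).fac
    (Cofan.mk Z φ) ⟨i⟩

lemma left_hom_ext {f g : R ⊗ (∐ F) ⟶ Z} (h : ∀ i, R ◁ Sigma.ι F i ≫ f = R ◁ Sigma.ι F i ≫ g) :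
    f = g :=
  (isColimitCofanMkObjOfIsColimit (tensorLeft R) F _ (coproductIsCoproduct F)).hom_ext
    fun ⟨i⟩ => h i

end SigmaTensor

/-- `V`-enriched quivers with set of vertices `S`. -/
@[ext]
structure VQuiv (V : Type u) (S : Type v) where
  obj : S → S → V

namespace VQuiv

variable {V : Type u} [Category.{v} V] {S : Type v}

/-- Quiver morphisms that are the identity on vertices. -/
@[ext]
structure Hom (P Q : VQuiv V S) where
  app : ∀ a b : S, P.obj a b ⟶ Q.obj a b

instance : Category (VQuiv V S) where
  Hom := Hom
  id P := ⟨fun a b => 𝟙 (P.obj a b)⟩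
  comp f g := ⟨fun a b => f.app a b ≫ g.app a b⟩

@[ext] lemma hom_ext {P Q : VQuiv V S} {f g : P ⟶ Q} (h : ∀ a b, f.app a b = g.app a b) : f = g :=
  Hom.ext (by funext a b; exact h a b)

@[simp] lemma id_app (P : VQuiv V S) (a b : S) : Hom.app (𝟙 P) a b = 𝟙 (P.obj a b) := rfl
@[simp] lemma comp_app {P Q R : VQuiv V S} (f : P ⟶ Q) (g : Q ⟶ R) (a b : S) :
    Hom.app (f ≫ g) a b = f.app a b ≫ g.app a b := rfl

variable (V) in
/-- Evaluation of quivers at a pair of vertices. -/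
@[simps]
def eval (a b : S) : VQuiv V S ⥤ V where
  obj P := P.obj a b
  map f := f.app a b

/-- Isomorphisms of quivers are given componentwise. -/
@[simps]
def isoMk {P Q : VQuiv V S} (e : ∀ a b, P.obj a b ≅ Q.obj a b) : P ≅ Q where
  hom := ⟨fun a b => (e a b).hom⟩
  inv := ⟨fun a b => (e a b).inv⟩

section Colimits

universe w w'

variable {J : Type*} [Category* J] [HasColimitsOfShape J V] (D : J ⥤ VQuiv V S)

/-- Colimits of quivers are computed for each pair of vertices separately. -/
def colimitCocone : ColimitCocone D where
  cocone :=
    { pt := ⟨fun a b => colimit (D ⋙ eval V a b)⟩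
      ι :=
        { app j := ⟨fun a b => colimit.ι (D ⋙ eval V a b) j⟩
          naturality i j f := by
            ext a b
            have := colimit.w (D ⋙ eval V a b) f
            simp at this ⊢
            exact this } }
  isColimit :=
    { desc s := ⟨fun a b => colimit.desc (D ⋙ eval V a b) ((eval V a b).mapCocone s)⟩
      fac s j := by ext a b; exact colimit.ι_desc _ _
      uniq s m hm := by
        refine hom_ext fun a b => colimit.hom_ext fun j => ?_
        exact (congrArg (fun f => Hom.app f a b) (hm j)).trans
          (colimit.ι_desc (F := D ⋙ eval V a b) ((eval V a b).mapCocone s) j).symm }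

instance : HasColimitsOfShape J (VQuiv V S) := ⟨fun D => ⟨⟨colimitCocone D⟩⟩⟩

instance [HasColimitsOfSize.{w, w'} V] : HasColimitsOfSize.{w, w'} (VQuiv V S) := ⟨inferInstance⟩

end Colimits

section Monoidal

variable [MonoidalCategory V] [SymmetricCategory V] [MonoidalClosed V] [HasColimits V]

/-- The tensor product `(P ⊗ Q)(a, b) = ∐_c P(a, c) ⊗ Q(c, b)`. -/
abbrev tensor (P Q : VQuiv V S) : VQuiv V S := ⟨fun a b => ∐ fun c => P.obj a c ⊗ Q.obj c b⟩

/-- The unit, with `I_S(a, b)` a coproduct of copies of `I` indexed by the proofs of `a = b`, that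
is `I` if `a = b` and an initial object otherwise. -/
abbrev unit : VQuiv V S := ⟨fun a b => ∐ fun _ : ULift.{v} (PLift (a = b)) => 𝟙_ V⟩

/-- The inclusion of `I` in `I_S(a, a)`. -/
abbrev unitinc (a : S) : 𝟙_ V ⟶ (unit (V := V) (S := S)).obj a a :=
  Sigma.ι (fun _ : ULift.{v} (PLift (a = a)) => 𝟙_ V) ⟨⟨rfl⟩⟩

/-- The inclusion of the summand at `c` of `P ⊗ Q`. -/
abbrev inc (P Q : VQuiv V S) (a c b : S) : P.obj a c ⊗ Q.obj c b ⟶ (tensor P Q).obj a b :=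
  Sigma.ι (fun c => P.obj a c ⊗ Q.obj c b) c

lemma tensor_ext {P Q : VQuiv V S} {a b : S} {Z : V} {f g : (tensor P Q).obj a b ⟶ Z}
    (h : ∀ c, inc P Q a c b ≫ f = inc P Q a c b ≫ g) : f = g :=
  Sigma.hom_ext _ _ h

def whiskL (P : VQuiv V S) {Q Q' : VQuiv V S} (g : Q ⟶ Q') : tensor P Q ⟶ tensor P Q' :=
  ⟨fun a b => Limits.Sigma.map fun c => P.obj a c ◁ g.app c b⟩

def whiskR {P P' : VQuiv V S} (f : P ⟶ P') (Q : VQuiv V S) : tensor P Q ⟶ tensor P' Q :=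
  ⟨fun a b => Limits.Sigma.map fun c => f.app a c ▷ Q.obj c b⟩

def homTensor {P P' Q Q' : VQuiv V S} (f : P ⟶ P') (g : Q ⟶ Q') : tensor P Q ⟶ tensor P' Q' :=
  ⟨fun a b => Limits.Sigma.map fun c => f.app a c ⊗ₘ g.app c b⟩

def assocHom (P Q R : VQuiv V S) : tensor (tensor P Q) R ⟶ tensor P (tensor Q R) :=
  ⟨fun a b => Sigma.desc fun d => descRight fun c =>
    (α_ (P.obj a c) (Q.obj c d) (R.obj d b)).hom ≫ P.obj a c ◁ inc Q R c d b ≫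
      inc P (tensor Q R) a c b⟩

def assocInv (P Q R : VQuiv V S) : tensor P (tensor Q R) ⟶ tensor (tensor P Q) R :=
  ⟨fun a b => Sigma.desc fun c => descLeft fun d =>
    (α_ (P.obj a c) (Q.obj c d) (R.obj d b)).inv ≫ inc P Q a c d ▷ R.obj d b ≫
      inc (tensor P Q) R a d b⟩

@[simp] lemma inc_assocHom (P Q R : VQuiv V S) (a c d b : S) :
    inc P Q a c d ▷ R.obj d b ≫ inc (tensor P Q) R a d b ≫ (assocHom P Q R).app a b =
    (α_ (P.obj a c) (Q.obj c d) (R.obj d b)).hom ≫ P.obj a c ◁ inc Q R c d b ≫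
      inc P (tensor Q R) a c b := by
  simp [assocHom]

@[simp] lemma inc_assocInv (P Q R : VQuiv V S) (a c d b : S) :
    P.obj a c ◁ inc Q R c d b ≫ inc P (tensor Q R) a c b ≫ (assocInv P Q R).app a b =
    (α_ (P.obj a c) (Q.obj c d) (R.obj d b)).inv ≫ inc P Q a c d ▷ R.obj d b ≫
      inc (tensor P Q) R a d b := by
  simp [assocInv]

def lamHom (P : VQuiv V S) : tensor unit P ⟶ P :=
  ⟨fun a b => Sigma.desc fun c => descRight fun h =>
    (λ_ (P.obj c b)).hom ≫ eqToHom (by rw [h.down.down])⟩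

def lamInv (P : VQuiv V S) : P ⟶ tensor unit P :=
  ⟨fun a b => (λ_ (P.obj a b)).inv ≫ unitinc a ▷ P.obj a b ≫ inc unit P a a b⟩

@[simp] lemma unitinc_lamHom (P : VQuiv V S) (a b : S) :
    unitinc a ▷ P.obj a b ≫ inc unit P a a b ≫ (lamHom P).app a b = (λ_ (P.obj a b)).hom := by
  simp [lamHom]

def rhoHom (P : VQuiv V S) : tensor P unit ⟶ P :=
  ⟨fun a b => Sigma.desc fun c => descLeft fun h =>
    (ρ_ (P.obj a c)).hom ≫ eqToHom (by rw [h.down.down])⟩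

def rhoInv (P : VQuiv V S) : P ⟶ tensor P unit :=
  ⟨fun a b => (ρ_ (P.obj a b)).inv ≫ P.obj a b ◁ unitinc b ≫ inc P unit a b b⟩

@[simp] lemma unitinc_rhoHom (P : VQuiv V S) (a b : S) :
    P.obj a b ◁ unitinc b ≫ inc P unit a b b ≫ (rhoHom P).app a b = (ρ_ (P.obj a b)).hom := by
  simp [rhoHom]

lemma tensor3_ext {P Q R : VQuiv V S} {a b : S} {Z : V}
    {f g : (tensor (tensor P Q) R).obj a b ⟶ Z}
    (h : ∀ c d, inc P Q a c d ▷ R.obj d b ≫ inc (tensor P Q) R a d b ≫ f =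
      inc P Q a c d ▷ R.obj d b ≫ inc (tensor P Q) R a d b ≫ g) : f = g :=
  tensor_ext fun d => right_hom_ext fun c => h c d

lemma tensor3_ext' {P Q R : VQuiv V S} {a b : S} {Z : V}
    {f g : (tensor P (tensor Q R)).obj a b ⟶ Z}
    (h : ∀ c d, P.obj a c ◁ inc Q R c d b ≫ inc P (tensor Q R) a c b ≫ f =
      P.obj a c ◁ inc Q R c d b ≫ inc P (tensor Q R) a c b ≫ g) : f = g :=
  tensor_ext fun c => left_hom_ext fun d => h c d

lemma tensor4_ext {P Q R T : VQuiv V S} {a b : S} {Z : V}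
    {f g : (tensor (tensor (tensor P Q) R) T).obj a b ⟶ Z}
    (h : ∀ c d e, inc P Q a c d ▷ R.obj d e ▷ T.obj e b ≫
      inc (tensor P Q) R a d e ▷ T.obj e b ≫ inc (tensor (tensor P Q) R) T a e b ≫ f =
      inc P Q a c d ▷ R.obj d e ▷ T.obj e b ≫
      inc (tensor P Q) R a d e ▷ T.obj e b ≫ inc (tensor (tensor P Q) R) T a e b ≫ g) : f = g := by
  refine tensor3_ext fun d e => ?_
  rw [← cancel_epi (α_ _ _ _).inv]
  refine right_hom_ext fun c => ?_
  have := h c d e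
  rw [← cancel_epi (α_ _ _ _).inv] at this
  simpa only [whiskerRight_tensor, Category.assoc, Iso.hom_inv_id_assoc] using this

lemma unit_tensor_ext {P : VQuiv V S} {a b : S} {Z : V}
    {f g : (tensor unit P).obj a b ⟶ Z}
    (h : unitinc a ▷ P.obj a b ≫ inc unit P a a b ≫ f =
      unitinc a ▷ P.obj a b ≫ inc unit P a a b ≫ g) : f = g :=
  tensor_ext fun c => right_hom_ext fun ⟨⟨hc⟩⟩ => by subst hc; exact h

lemma tensor_unit_ext {P : VQuiv V S} {a b : S} {Z : V}
    {f g : (tensor P unit).obj a b ⟶ Z}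
    (h : P.obj a b ◁ unitinc b ≫ inc P unit a b b ≫ f =
      P.obj a b ◁ unitinc b ≫ inc P unit a b b ≫ g) : f = g :=
  tensor_ext fun c => left_hom_ext fun ⟨⟨hc⟩⟩ => by subst hc; exact h

lemma inc_whiskL (P : VQuiv V S) {Q Q' : VQuiv V S} (g : Q ⟶ Q') (a c b : S) :
    inc P Q a c b ≫ (whiskL P g).app a b = P.obj a c ◁ g.app c b ≫ inc P Q' a c b := by
  simp [whiskL]

lemma inc_whiskR {P P' : VQuiv V S} (f : P ⟶ P') (Q : VQuiv V S) (a c b : S) :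
    inc P Q a c b ≫ (whiskR f Q).app a b = f.app a c ▷ Q.obj c b ≫ inc P' Q a c b := by
  simp [whiskR]

lemma inc_homTensor {P P' Q Q' : VQuiv V S} (f : P ⟶ P') (g : Q ⟶ Q') (a c b : S) :
    inc P Q a c b ≫ (homTensor f g).app a b = (f.app a c ⊗ₘ g.app c b) ≫ inc P' Q' a c b := by
  simp [homTensor]

instance : MonoidalCategoryStruct (VQuiv V S) where
  tensorObj := tensor
  whiskerLeft P _ _ g := whiskL P g
  whiskerRight f Q := whiskR f Q
  tensorHom := homTensor
  tensorUnit := unit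
  associator P Q R :=
    { hom := assocHom P Q R
      inv := assocInv P Q R
      hom_inv_id := by
        refine hom_ext fun a b => tensor3_ext fun c d => ?_
        rw [comp_app, reassoc_of% inc_assocHom, inc_assocInv]
        simp
      inv_hom_id := by
        refine hom_ext fun a b => tensor3_ext' fun c d => ?_
        rw [comp_app, reassoc_of% inc_assocInv, inc_assocHom]
        simp }
  leftUnitor P :=
    { hom := lamHom P
      inv := lamInv P
      hom_inv_id := by
        refine hom_ext fun a b => unit_tensor_ext ?_
        rw [comp_app, reassoc_of% unitinc_lamHom]
        simp [lamInv]
      inv_hom_id := by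
        refine hom_ext fun a b => ?_
        simp only [lamInv, comp_app, Category.assoc, unitinc_lamHom]
        simp }
  rightUnitor P :=
    { hom := rhoHom P
      inv := rhoInv P
      hom_inv_id := by
        refine hom_ext fun a b => tensor_unit_ext ?_
        rw [comp_app, reassoc_of% unitinc_rhoHom]
        simp [rhoInv]
      inv_hom_id := by
        refine hom_ext fun a b => ?_
        simp only [rhoInv, comp_app, Category.assoc, unitinc_rhoHom]
        simp }

/-- The inclusion of a summand of a tensor product of quivers. -/
def tinc (P Q : VQuiv V S) (a c b : S) : P.obj a c ⊗ Q.obj c b ⟶ (P ⊗ Q).obj a b := inc P Q a c b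

variable {P P' Q Q' R T : VQuiv V S} {a b c d : S} {Z : V}

@[simp] lemma tinc_whiskerLeft (P : VQuiv V S) {Q Q' : VQuiv V S} (g : Q ⟶ Q') (a c b : S) :
    tinc P Q a c b ≫ Hom.app (P ◁ g) a b = P.obj a c ◁ g.app c b ≫ tinc P Q' a c b :=
  inc_whiskL P g a c b

@[simp] lemma tinc_whiskerLeft_assoc (g : Q ⟶ Q') (a c b : S) (h : (P ⊗ Q').obj a b ⟶ Z) :
    tinc P Q a c b ≫ Hom.app (P ◁ g) a b ≫ h = P.obj a c ◁ g.app c b ≫ tinc P Q' a c b ≫ h := by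
  rw [reassoc_of% tinc_whiskerLeft]

@[simp] lemma tinc_whiskerRight (f : P ⟶ P') (Q : VQuiv V S) (a c b : S) :
    tinc P Q a c b ≫ Hom.app (f ▷ Q) a b = f.app a c ▷ Q.obj c b ≫ tinc P' Q a c b :=
  inc_whiskR f Q a c b

@[simp] lemma tinc_whiskerRight_assoc (f : P ⟶ P') (a c b : S) (h : (P' ⊗ Q).obj a b ⟶ Z) :
    tinc P Q a c b ≫ Hom.app (f ▷ Q) a b ≫ h = f.app a c ▷ Q.obj c b ≫ tinc P' Q a c b ≫ h := by
  rw [reassoc_of% tinc_whiskerRight]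

@[simp] lemma tinc_tensorHom (f : P ⟶ P') (g : Q ⟶ Q') (a c b : S) :
    tinc P Q a c b ≫ Hom.app (f ⊗ₘ g) a b = (f.app a c ⊗ₘ g.app c b) ≫ tinc P' Q' a c b :=
  inc_homTensor f g a c b

@[simp] lemma tinc_tensorHom_assoc (f : P ⟶ P') (g : Q ⟶ Q') (a c b : S)
    (h : (P' ⊗ Q').obj a b ⟶ Z) :
    tinc P Q a c b ≫ Hom.app (f ⊗ₘ g) a b ≫ h =
      (f.app a c ⊗ₘ g.app c b) ≫ tinc P' Q' a c b ≫ h := by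
  rw [reassoc_of% tinc_tensorHom]

@[simp] lemma tinc_associator (P Q R : VQuiv V S) (a c d b : S) :
    tinc P Q a c d ▷ R.obj d b ≫ tinc (P ⊗ Q) R a d b ≫ Hom.app (α_ P Q R).hom a b =
    (α_ (P.obj a c) (Q.obj c d) (R.obj d b)).hom ≫ P.obj a c ◁ tinc Q R c d b ≫
      tinc P (Q ⊗ R) a c b :=
  inc_assocHom P Q R a c d b

@[simp] lemma tinc_associator_assoc (P Q R : VQuiv V S) (a c d b : S)
    (h : (P ⊗ (Q ⊗ R)).obj a b ⟶ Z) :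
    tinc P Q a c d ▷ R.obj d b ≫ tinc (P ⊗ Q) R a d b ≫ Hom.app (α_ P Q R).hom a b ≫ h =
    (α_ (P.obj a c) (Q.obj c d) (R.obj d b)).hom ≫ P.obj a c ◁ tinc Q R c d b ≫
      tinc P (Q ⊗ R) a c b ≫ h := by
  rw [reassoc_of% tinc_associator]

/-- The canonical morphism from the unit of `V` to the unit quiver. -/
def oneInc (V : Type u) [Category.{v} V] [MonoidalCategory V] [SymmetricCategory V]
  [MonoidalClosed V] [HasColimits V] {S : Type v} (a : S) : 𝟙_ V ⟶ (𝟙_ (VQuiv V S)).obj a a := unitinc a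

@[simp] lemma oneInc_leftUnitor (P : VQuiv V S) (a b : S) :
    oneInc V a ▷ P.obj a b ≫ tinc (𝟙_ _) P a a b ≫ Hom.app (λ_ P).hom a b = (λ_ (P.obj a b)).hom :=
  unitinc_lamHom P a b

@[simp] lemma oneInc_rightUnitor (P : VQuiv V S) (a b : S) :
    P.obj a b ◁ oneInc V b ≫ tinc P (𝟙_ _) a b b ≫ Hom.app (ρ_ P).hom a b = (ρ_ (P.obj a b)).hom :=
  unitinc_rhoHom P a b

lemma tinc_ext {f g : (P ⊗ Q).obj a b ⟶ Z}
    (h : ∀ c, tinc P Q a c b ≫ f = tinc P Q a c b ≫ g) : f = g :=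
  tensor_ext h

instance : MonoidalCategory (VQuiv V S) where
  tensorHom_def f g := hom_ext fun a b => tinc_ext fun c => by
    simp [MonoidalCategory.tensorHom_def]
  id_tensorHom_id P Q := hom_ext fun a b => tinc_ext fun c => by simp
  tensorHom_comp_tensorHom f g h k := hom_ext fun a b => tinc_ext fun c => by simp
  whiskerLeft_id P Q := hom_ext fun a b => tinc_ext fun c => by simp
  id_whiskerRight P Q := hom_ext fun a b => tinc_ext fun c => by simp
  associator_naturality {P Q R P' Q' R'} f g h := hom_ext fun a b => tensor3_ext fun c d => by
    have e1 : tinc P Q a c d ▷ R.obj d b ≫ (Hom.app (f ⊗ₘ g) a d ⊗ₘ h.app d b) =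
        ((f.app a c ⊗ₘ g.app c d) ⊗ₘ h.app d b) ≫ tinc P' Q' a c d ▷ R'.obj d b := by
      rw [← tensorHom_id, ← tensorHom_id, tensorHom_comp_tensorHom, tensorHom_comp_tensorHom,
        tinc_tensorHom]
      simp
    have e2 : P.obj a c ◁ tinc Q R c d b ≫ (f.app a c ⊗ₘ Hom.app (g ⊗ₘ h) c b) =
        (f.app a c ⊗ₘ (g.app c d ⊗ₘ h.app d b)) ≫ P'.obj a c ◁ tinc Q' R' c d b := by
      rw [← id_tensorHom, ← id_tensorHom, tensorHom_comp_tensorHom, tensorHom_comp_tensorHom,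
        tinc_tensorHom]
      simp
    change tinc P Q a c d ▷ R.obj d b ≫ tinc (P ⊗ Q) R a d b ≫ Hom.app _ a b ≫ Hom.app _ a b =
      tinc P Q a c d ▷ R.obj d b ≫ tinc (P ⊗ Q) R a d b ≫ Hom.app _ a b ≫ Hom.app _ a b
    rw [tinc_tensorHom_assoc, reassoc_of% e1, tinc_associator, tinc_associator_assoc,
      tinc_tensorHom, reassoc_of% e2]
    simp
  leftUnitor_naturality {P P'} f := hom_ext fun a b => unit_tensor_ext (by
    change oneInc V a ▷ P.obj a b ≫ tinc _ P a a b ≫ Hom.app _ a b ≫ Hom.app _ a b =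
      oneInc V a ▷ P.obj a b ≫ tinc _ P a a b ≫ Hom.app _ a b ≫ Hom.app _ a b
    rw [tinc_whiskerLeft_assoc, ← whisker_exchange_assoc, oneInc_leftUnitor,
      reassoc_of% oneInc_leftUnitor]
    simp)
  rightUnitor_naturality {P P'} f := hom_ext fun a b => tensor_unit_ext (by
    change P.obj a b ◁ oneInc V b ≫ tinc P _ a b b ≫ Hom.app _ a b ≫ Hom.app _ a b =
      P.obj a b ◁ oneInc V b ≫ tinc P _ a b b ≫ Hom.app _ a b ≫ Hom.app _ a b
    rw [tinc_whiskerRight_assoc, whisker_exchange_assoc, oneInc_rightUnitor,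
      reassoc_of% oneInc_rightUnitor]
    simp)
  pentagon P Q R T := hom_ext fun a b => tensor4_ext fun c d e => by
    change tinc P Q a c d ▷ R.obj d e ▷ T.obj e b ≫ tinc (P ⊗ Q) R a d e ▷ T.obj e b ≫
        tinc ((P ⊗ Q) ⊗ R) T a e b ≫ Hom.app _ a b ≫ Hom.app _ a b ≫ Hom.app _ a b =
      tinc P Q a c d ▷ R.obj d e ▷ T.obj e b ≫ tinc (P ⊗ Q) R a d e ▷ T.obj e b ≫
        tinc ((P ⊗ Q) ⊗ R) T a e b ≫ Hom.app _ a b ≫ Hom.app _ a b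
    have e1 := congrArg (fun f => f ▷ T.obj e b) (tinc_associator P Q R a c d e)
    simp only [comp_whiskerRight] at e1
    have e2 := congrArg (fun f => P.obj a c ◁ f) (tinc_associator Q R T c d e b)
    simp only [MonoidalCategory.whiskerLeft_comp] at e2
    have e3 := tinc_associator P (Q ⊗ R) T a c e b
    have e4 := tinc_associator (P ⊗ Q) R T a d e b
    have e5 := tinc_associator P Q (R ⊗ T) a c d b
    rw [tinc_whiskerRight_assoc, reassoc_of% e1, reassoc_of% e3, tinc_whiskerLeft]
    rw [reassoc_of% e4]
    rw [associator_naturality_middle_assoc, reassoc_of% e2, associator_naturality_left_assoc,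
      ← whisker_exchange_assoc, e5, associator_naturality_right_assoc, pentagon_assoc]
  triangle P Q := hom_ext fun a b => tensor_ext fun d => by
    have hi : IsIso (Hom.app (ρ_ P).inv a d) :=
      inferInstanceAs (IsIso ((eval V a d).map (ρ_ P).inv))
    have e0 : Hom.app (ρ_ P).inv a d =
      (ρ_ (P.obj a d)).inv ≫ P.obj a d ◁ oneInc V d ≫ tinc P (𝟙_ _) a d d := rfl
    have e1 : Hom.app (ρ_ P).inv a d ≫ Hom.app (ρ_ P).hom a d = 𝟙 _ := by
      rw [← comp_app, Iso.inv_hom_id, id_app]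
    have e2 := congrArg (fun f => P.obj a d ◁ f) (oneInc_leftUnitor Q d b)
    simp only [MonoidalCategory.whiskerLeft_comp] at e2
    have e3 := tinc_associator P (𝟙_ _) Q a d d b
    refine (cancel_epi (Hom.app (ρ_ P).inv a d ▷ Q.obj d b)).1 ?_
    change _ ≫ tinc (P ⊗ 𝟙_ _) Q a d b ≫ Hom.app _ a b ≫ Hom.app _ a b =
      _ ≫ tinc (P ⊗ 𝟙_ _) Q a d b ≫ Hom.app _ a b
    rw [tinc_whiskerRight, ← comp_whiskerRight_assoc, e1, id_whiskerRight, Category.id_comp, e0,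
      comp_whiskerRight_assoc, comp_whiskerRight_assoc, reassoc_of% e3, tinc_whiskerLeft,
      associator_naturality_middle_assoc, reassoc_of% e2]
    simp

end Monoidal

end VQuiv

section Paths

variable {W : Type*} [Category* W] [MonoidalCategory W]

/-- For `L = [t₁, …, tₖ]`, the tensor product `A (t₁ - s) ⊗ A (t₂ - t₁) ⊗ … ⊗ A (tₖ - tₖ₋₁)`,
bracketed to the right and ending in the unit. -/
@[reducible] def pathTensor (A : ℕ → W) : ℕ → List ℕ → W
  | _, [] => 𝟙_ W
  | s, t :: L => A (t - s) ⊗ pathTensor A t L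

namespace FinInt

/-- The canonical identification `[t - s] + [u - t] → [u - s]` for `s ≤ t ≤ u`. -/
def glue (s t u : ℕ) : (⟨t - s⟩ ⊗ ⟨u - t⟩ : FinInt) ⟶ ⟨u - s⟩ :=
  homMk (fun i => min i (u - s)) (fun i j h _ => by omega) (by simp)
    (by simp only [tensor_len]; omega)

lemma ev_glue (s t u i : ℕ) : ev (glue s t u) i = min i (u - s) := by
  refine (ev_homMk _ _ _ _ _).trans ?_
  simp only [tensor_len]; omega

/-- The restriction `[t - s] → [f t - f s]` of `f` to the interval from `s` to `t`. -/
def res {m n : FinInt} (f : m ⟶ n) (s t r q : ℕ) (hs : ev f s = r) (ht : ev f t = q) :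
    (⟨t - s⟩ : FinInt) ⟶ ⟨q - r⟩ :=
  homMk (fun i => ev f (s + i) - r)
    (fun i j h _ => by have := ev_mono f (show s + i ≤ s + j by omega); omega)
    (by simp [hs])
    (by
      subst hs ht
      rcases le_total s t with h | h
      · simp [Nat.add_sub_cancel' h]
      · have := ev_mono f h
        simp only [Nat.sub_eq_zero_of_le h, Nat.sub_eq_zero_of_le this]; simp)

lemma ev_res {m n : FinInt} (f : m ⟶ n) (s t r q : ℕ) (hs : ev f s = r) (ht : ev f t = q)
    (i : ℕ) : ev (res f s t r q hs ht) i = ev f (s + min i (t - s)) - r :=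
  ev_homMk _ _ _ _ _

lemma toZero_unique' {n : FinInt} (f g : n ⟶ 𝟙_ FinInt) : f = g := hom_ext fun i _ => by
  have h1 := ev_le f i
  have h2 := ev_le g i
  simp only [unit_len] at *
  omega

/-- The opposite of the unique morphism `[n] → [0]`. -/
def toZero (n : ℕ) : 𝟙_ FinIntᵒᵖ ⟶ op ⟨n⟩ :=
  Quiver.Hom.op (homMk (m := ⟨n⟩) (n := 𝟙_ FinInt) (fun _ => 0) (fun _ _ _ _ => le_rfl) rfl rfl)

lemma ev_toZero (n i : ℕ) : ev (toZero n).unop i = 0 := rfl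

lemma toZero_unique {n : FinIntᵒᵖ} (f g : 𝟙_ FinIntᵒᵖ ⟶ n) : f = g :=
  Quiver.Hom.unop_inj (toZero_unique' f.unop g.unop)

/-- `glue` in the opposite category. -/
def glueOp (s t u : ℕ) : (op ⟨u - s⟩ : FinIntᵒᵖ) ⟶ op ⟨t - s⟩ ⊗ op ⟨u - t⟩ := (glue s t u).op

end FinInt

open FinInt

variable (X : FinIntᵒᵖ ⥤ W)

/-- The object `X_n`. -/
abbrev simplices (n : ℕ) : W := X.obj (op ⟨n⟩)

variable [X.OplaxMonoidal]

/-- The comultiplication `X_{u - s} → X_{t - s} ⊗ X_{u - t}` for `s ≤ t ≤ u`. -/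
def split (s t u : ℕ) : simplices X (u - s) ⟶ simplices X (t - s) ⊗ simplices X (u - t) :=
  X.map (glueOp s t u) ≫ Functor.OplaxMonoidal.δ X (op ⟨t - s⟩) (op ⟨u - t⟩)

lemma split_coassoc {s t u w : ℕ} (h1 : s ≤ t) (h2 : t ≤ u) (h3 : u ≤ w) :
    split X s t w ≫ simplices X (t - s) ◁ split X t u w =
      split X s u w ≫ split X s t u ▷ simplices X (w - u) ≫ (α_ _ _ _).hom := by
  have e : glueOp s t w ≫ op ⟨t - s⟩ ◁ glueOp t u w =
      glueOp s u w ≫ glueOp s t u ▷ op ⟨w - u⟩ ≫ (α_ _ _ _).hom := by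
    refine Quiver.Hom.unop_inj (hom_ext fun i hi => ?_)
    change ev ((⟨t - s⟩ ◁ glue t u w) ≫ glue s t w) i =
      ev (((α_ _ _ _).inv ≫ glue s t u ▷ ⟨w - u⟩) ≫ glue s u w) i
    replace hi : i ≤ (t - s) + ((u - t) + (w - u)) := hi
    simp only [ev_comp, ev_whiskerLeft, ev_whiskerRight, ev_glue, ev_associator_inv, tensor_len] at *
    split_ifs <;> omega
  simp only [split, MonoidalCategory.whiskerLeft_comp, comp_whiskerRight, Category.assoc,
    Functor.OplaxMonoidal.δ_natural_left_assoc, Functor.OplaxMonoidal.δ_natural_right_assoc,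
    Functor.OplaxMonoidal.associativity]
  simp only [← X.map_comp_assoc, e]

lemma split_nat {m n : FinInt} (f : m ⟶ n) {s t u r q v : ℕ} (h1 : s ≤ t) (h2 : t ≤ u)
    (hs : ev f s = r) (ht : ev f t = q) (hu : ev f u = v) :
    split X r q v ≫ (X.map (res f s t r q hs ht).op ⊗ₘ X.map (res f t u q v ht hu).op) =
      X.map (res f s u r v hs hu).op ≫ split X s t u := by
  have e : glueOp r q v ≫ ((res f s t r q hs ht).op ⊗ₘ (res f t u q v ht hu).op) =
      (res f s u r v hs hu).op ≫ glueOp s t u := by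
    refine Quiver.Hom.unop_inj (hom_ext fun i hi => ?_)
    change ev ((res f s t r q hs ht ⊗ₘ res f t u q v ht hu) ≫ glue r q v) i =
      ev (glue s t u ≫ res f s u r v hs hu) i
    replace hi : i ≤ (t - s) + (u - t) := hi
    have e1 := ev_mono f (show s ≤ s + i by omega)
    have e2 := ev_mono f h1
    have e3 := ev_mono f h2
    simp only [ev_comp, ev_tensorHom, ev_glue, ev_res] at *
    have e4 : i ≤ t - s → min i (t - s) = i := fun h => by omega
    have e5 : ¬ i ≤ t - s → t + min (i - (t - s)) (u - t) = s + i := fun h => by omega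
    have e6 : min (min i (u - s)) (u - s) = i := by omega
    have e7 := ev_mono f (show s + i ≤ u by omega)
    have e8 : ¬ i ≤ t - s → ev f t ≤ ev f (s + i) := fun h => ev_mono f (by omega)
    rw [e6]
    split_ifs with h
    · rw [e4 h]; omega
    · rw [e5 h]; have := e8 h; omega
  simp only [split, Category.assoc, Functor.OplaxMonoidal.δ_natural, ← X.map_comp_assoc, e]

variable [IsIso (Functor.OplaxMonoidal.η X)]

/-- The totally degenerate morphism `I ≅ X_0 → X_n`. -/
def unitMap (n : ℕ) : 𝟙_ W ⟶ simplices X n :=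
  inv (Functor.OplaxMonoidal.η X) ≫ X.map (toZero n)

lemma unitMap_map {m n : ℕ} (f : (⟨m⟩ : FinInt) ⟶ ⟨n⟩) :
    unitMap X n ≫ X.map f.op = unitMap X m := by
  rw [unitMap, unitMap, Category.assoc, ← X.map_comp, toZero_unique (toZero n ≫ f.op) (toZero m)]

lemma split_left (s u : ℕ) :
    split X s s u = (λ_ _).inv ≫ unitMap X (s - s) ▷ simplices X (u - s) := by
  have e : glueOp s s u = (λ_ _).inv ≫ toZero (s - s) ▷ op ⟨u - s⟩ := by
    refine Quiver.Hom.unop_inj (hom_ext fun i hi => ?_)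
    change ev (glue s s u) i = ev ((toZero (s - s)).unop ▷ ⟨u - s⟩ ≫ (λ_ _).hom) i
    replace hi : i ≤ (s - s) + (u - s) := hi
    simp only [ev_comp, ev_whiskerRight, ev_glue, ev_leftUnitor_hom, ev_toZero]
    have h0 : (unop (𝟙_ FinIntᵒᵖ)).len = 0 := rfl
    split_ifs <;> omega
  rw [Functor.OplaxMonoidal.left_unitality]
  simp only [Category.assoc, ← comp_whiskerRight, unitMap, IsIso.hom_inv_id_assoc,
    Functor.OplaxMonoidal.δ_natural_left, split, e, X.map_comp]

lemma split_right (s u : ℕ) :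
    split X s u u = (ρ_ _).inv ≫ simplices X (u - s) ◁ unitMap X (u - u) := by
  have e : glueOp s u u = (ρ_ _).inv ≫ op ⟨u - s⟩ ◁ toZero (u - u) := by
    refine Quiver.Hom.unop_inj (hom_ext fun i hi => ?_)
    change ev (glue s u u) i = ev (⟨u - s⟩ ◁ (toZero (u - u)).unop ≫ (ρ_ _).hom) i
    replace hi : i ≤ (u - s) + (u - u) := hi
    simp only [ev_comp, ev_whiskerLeft, ev_glue, ev_rightUnitor_hom, ev_toZero]
    split_ifs <;> omega
  rw [Functor.OplaxMonoidal.right_unitality]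
  simp only [Category.assoc, ← MonoidalCategory.whiskerLeft_comp, unitMap,
    IsIso.hom_inv_id_assoc, Functor.OplaxMonoidal.δ_natural_right, split, e, X.map_comp]

lemma unitMap_split (s t u : ℕ) :
    unitMap X (u - s) ≫ split X s t u =
      (λ_ _).inv ≫ (unitMap X (t - s) ⊗ₘ unitMap X (u - t)) := by
  have e : toZero (u - s) ≫ glueOp s t u = (λ_ _).inv ≫ (toZero (t - s) ⊗ₘ toZero (u - t)) := by
    refine Quiver.Hom.unop_inj (toZero_unique' _ _)
  have e1 : Functor.OplaxMonoidal.η X ≫ (λ_ _).inv =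
      X.map (λ_ _).inv ≫ Functor.OplaxMonoidal.δ X _ _ ≫
        (Functor.OplaxMonoidal.η X ⊗ₘ Functor.OplaxMonoidal.η X) := by
    rw [leftUnitor_inv_naturality, Functor.OplaxMonoidal.left_unitality,
      MonoidalCategory.tensorHom_def]
    simp only [Category.assoc]
  rw [← cancel_epi (Functor.OplaxMonoidal.η X), unitMap, unitMap, unitMap,
    ← tensorHom_comp_tensorHom, reassoc_of% e1]
  simp only [split, Category.assoc, IsIso.hom_inv_id_assoc, tensorHom_comp_tensorHom_assoc,
    IsIso.hom_inv_id, id_tensorHom_id, Category.id_comp, Functor.OplaxMonoidal.δ_natural,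
    ← X.map_comp_assoc, e]

/-- The inert part: if `M` is obtained from the increasing list `L` by omitting entries, the
morphism obtained by inserting the missing entries through the comultiplication. Entries that
equal their predecessor are inserted through `I ≅ X_0`. -/
def refine : (s : ℕ) → (M L : List ℕ) → M.Sublist L →
    (pathTensor (simplices X) s M ⟶ pathTensor (simplices X) s L)
  | _, [], [], _ => 𝟙 _
  | _, _ :: _, [], h => absurd h (by simp)
  | s, [], t :: L, _ => (λ_ (𝟙_ W)).inv ≫ (unitMap X (t - s) ⊗ₘ refine t [] L (by simp))
  | s, u :: M, t :: L, h =>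
    if hut : u = t then
      simplices X (u - s) ◁ refine u M L (by subst hut; simpa using h) ≫ eqToHom (by rw [hut])
    else
      split X s t u ▷ pathTensor (simplices X) u M ≫ (α_ _ _ _).hom ≫
        simplices X (t - s) ◁ refine t (u :: M) L (by
          rcases List.sublist_cons_iff.1 h with h | ⟨_, h, _⟩
          · exact h
          · exact absurd (List.cons.inj h).1 hut)

lemma sublist_of_ne {t u : ℕ} {M L : List ℕ} (h : (u :: M).Sublist (t :: L)) (hut : u ≠ t) :
    (u :: M).Sublist L := by
  rcases List.sublist_cons_iff.1 h with h | ⟨_, h, _⟩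
  · exact h
  · exact absurd (List.cons.inj h).1 hut

lemma refine_keep (s t : ℕ) {M L : List ℕ} (h : (t :: M).Sublist (t :: L))
    (h' : M.Sublist L) :
    refine X s (t :: M) (t :: L) h = simplices X (t - s) ◁ refine X t M L h' := by
  simp only [refine, dite_true]
  exact Category.comp_id _

lemma refine_split (s : ℕ) {t u : ℕ} {M L : List ℕ} (h : (u :: M).Sublist (t :: L))
    (h' : (u :: M).Sublist L) (hut : u ≠ t) :
    refine X s (u :: M) (t :: L) h = split X s t u ▷ pathTensor (simplices X) u M ≫
      (α_ _ _ _).hom ≫ simplices X (t - s) ◁ refine X t (u :: M) L h' := by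
  simp only [refine, hut, dite_false]

lemma refine_nil (s t : ℕ) (L : List ℕ) (h : [].Sublist (t :: L)) :
    refine X s [] (t :: L) h =
      (λ_ (𝟙_ W)).inv ≫ (unitMap X (t - s) ⊗ₘ refine X t [] L (by simp)) := by
  simp only [refine]

lemma refine_self (s : ℕ) (L : List ℕ) (h : L.Sublist L) : refine X s L L h = 𝟙 _ := by
  induction L generalizing s with
  | nil => simp [refine]
  | cons t L ih => rw [refine_keep X s t h (List.Sublist.refl L), ih,
    MonoidalCategory.whiskerLeft_id]

/-- Insertion of a trivial bead. -/
def ins (s : ℕ) (M : List ℕ) :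
    pathTensor (simplices X) s M ⟶ pathTensor (simplices X) s (s :: M) :=
  (λ_ _).inv ≫ unitMap X (s - s) ▷ pathTensor (simplices X) s M

lemma ins_nat (s : ℕ) {M L : List ℕ}
    (r : pathTensor (simplices X) s M ⟶ pathTensor (simplices X) s L) :
    r ≫ ins X s L = ins X s M ≫ simplices X (s - s) ◁ r := by
  rw [ins, ins, leftUnitor_inv_naturality_assoc, Category.assoc, whisker_exchange]

instance (s : ℕ) : IsIso (unitMap X (s - s)) := by
  have : IsIso (toZero (s - s)) := by
    rw [toZero_unique (toZero (s - s)) (castIso (m := ⟨s - s⟩) (n := 𝟙_ FinInt)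
      (Nat.sub_self s)).hom.op]
    infer_instance
  unfold unitMap
  infer_instance

lemma ins_cons_self (s : ℕ) (M : List ℕ) :
    ins X s (s :: M) = simplices X (s - s) ◁ ins X s M := by
  refine (cancel_epi (unitMap X (s - s) ▷ pathTensor (simplices X) s M)).1 ?_
  change _ ≫ (λ_ (simplices X (s - s) ⊗ pathTensor (simplices X) s M)).inv ≫
    unitMap X (s - s) ▷ (simplices X (s - s) ⊗ pathTensor (simplices X) s M) = _ ≫ _ ◁ ((λ_ _).inv ≫
      unitMap X (s - s) ▷ pathTensor (simplices X) s M)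
  rw [leftUnitor_inv_naturality_assoc, whisker_exchange, MonoidalCategory.whiskerLeft_comp,
    ← whisker_exchange_assoc]
  congr 1
  monoidal

lemma ins_cons (s u : ℕ) (M : List ℕ) :
    ins X s (u :: M) = split X s s u ▷ pathTensor (simplices X) u M ≫ (α_ _ _ _).hom := by
  rw [split_left]
  change (λ_ (simplices X (u - s) ⊗ pathTensor (simplices X) u M)).inv ≫
    unitMap X (s - s) ▷ (simplices X (u - s) ⊗ pathTensor (simplices X) u M) = _
  simp [-Functor.OplaxMonoidal.left_unitality]

lemma ins_cons_right (s u : ℕ) (M : List ℕ) :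
    split X s u u ▷ pathTensor (simplices X) u M ≫ (α_ _ _ _).hom =
      simplices X (u - s) ◁ ins X u M := by
  rw [split_right, ins]
  simp [-Functor.OplaxMonoidal.right_unitality]

lemma ins_refine (s : ℕ) (L : List ℕ) (hL : (s :: L).Pairwise (· ≤ ·)) (M : List ℕ)
    (h : (s :: M).Sublist L) (h' : M.Sublist L) :
    ins X s M ≫ refine X s (s :: M) L h = refine X s M L h' := by
  induction L generalizing M with
  | nil => simp at h
  | cons t L ih =>
    have hL' := hL
    simp only [List.pairwise_cons, List.mem_cons, forall_eq_or_imp] at hL'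
    obtain ⟨⟨hst, hsL⟩, htL, hL2⟩ := hL'
    have hts : s = t := by
      by_contra hne
      rcases List.sublist_cons_iff.1 h with h | ⟨_, h, _⟩
      · have := htL s (h.subset (by simp))
        omega
      · exact hne (List.cons.inj h).1
    subst hts
    have h1 : M.Sublist L := by simpa using h
    rw [refine_keep X s s h h1]
    cases M with
    | nil =>
      rw [refine_nil, ins, MonoidalCategory.tensorHom_def, Category.assoc]
    | cons u M =>
      by_cases hu : u = s
      · subst hu
        have h2 : M.Sublist L := by simpa using h'
        rw [refine_keep X u u h' h2, ins_cons_self, ← MonoidalCategory.whiskerLeft_comp,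
          ih (by simpa using ⟨hsL, hL2⟩) M h1 h2]
      · rw [refine_split X s h' h1 hu, ins_cons, Category.assoc]

lemma refine_comp (s : ℕ) (N M L : List ℕ) (hL : (s :: L).Pairwise (· ≤ ·))
    (hN : N.Sublist M) (hM : M.Sublist L) (h : N.Sublist L) :
    refine X s N M hN ≫ refine X s M L hM = refine X s N L h := by
  induction L generalizing s N M with
  | nil =>
    obtain rfl : M = [] := by simpa using hM
    obtain rfl : N = [] := by simpa using hN
    rw [refine_self, Category.id_comp]
  | cons t L ih =>
    have hL' := hL
    simp only [List.pairwise_cons, List.mem_cons, forall_eq_or_imp] at hL'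
    obtain ⟨⟨hst, hsL⟩, htL, hL2⟩ := hL'
    have hL3 : (t :: L).Pairwise (· ≤ ·) := by simpa using ⟨htL, hL2⟩
    cases M with
    | nil =>
      obtain rfl : N = [] := by simpa using hN
      rw [refine_self, Category.id_comp]
    | cons u M =>
      by_cases hu : u = t
      · subst hu
        have hM1 : M.Sublist L := by simpa using hM
        rw [refine_keep X s u hM hM1]
        cases N with
        | nil =>
          rw [refine_nil, refine_nil, ← ih u [] M hL3 (by simp) hM1 (by simp)]
          simp [MonoidalCategory.tensorHom_def]
        | cons w N =>
          by_cases hw : w = u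
          · subst hw
            have hN1 : N.Sublist M := by simpa using hN
            have h1 : N.Sublist L := by simpa using h
            rw [refine_keep X s w hN hN1, refine_keep X s w h h1,
              ← MonoidalCategory.whiskerLeft_comp, ih w N M hL3 hN1 hM1 h1]
          · have hN1 := sublist_of_ne hN hw
            rw [refine_split X s hN hN1 hw, refine_split X s h (hN1.trans hM1) hw,
              ← ih u (w :: N) M hL3 hN1 hM1 (hN1.trans hM1)]
            simp only [MonoidalCategory.whiskerLeft_comp, Category.assoc]
      · have hM1 := sublist_of_ne hM hu
        have htu := htL u (hM1.subset (by simp))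
        rw [refine_split X s hM hM1 hu]
        cases N with
        | nil =>
          rw [refine_nil, refine_nil, ← ih t [] (u :: M) hL3 (by simp) hM1 (by simp), refine_nil,
            MonoidalCategory.tensorHom_def]
          have e := unitMap_split X s t u
          simp only [Category.assoc]
          rw [whisker_exchange_assoc, ← comp_whiskerRight_assoc, e]
          simp only [MonoidalCategory.tensorHom_def, Category.assoc, comp_whiskerRight,
            MonoidalCategory.whiskerLeft_comp]
          monoidal
        | cons w N =>
          by_cases hw : w = u
          · subst hw
            have hN1 : N.Sublist M := by simpa using hN
            rw [refine_keep X s w hN hN1, refine_split X s h ((hN.trans hM1)) hu,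
              ← ih t (w :: N) (w :: M) hL3 hN hM1 (hN.trans hM1), refine_keep X t w hN hN1]
            simp only [MonoidalCategory.whiskerLeft_comp, whisker_exchange_assoc,
              tensor_whiskerLeft, Category.assoc, Iso.inv_hom_id_assoc]
          · have hN1 := sublist_of_ne hN hw
            have hMs : (u :: M).Pairwise (· ≤ ·) := hL2.sublist hM1
            have huw : u ≤ w := (List.pairwise_cons.1 hMs).1 w (hN1.subset (by simp))
            have hwt : w ≠ t := by omega
            rw [refine_split X s hN hN1 hw, refine_split X s h (hN.trans hM1) hwt,
              ← ih t (w :: N) (u :: M) hL3 hN hM1 (hN.trans hM1), refine_split X t hN hN1 hw]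
            have e := congrArg (fun f => f ▷ pathTensor (simplices X) w N)
              (split_coassoc X hst htu huw)
            simp only [comp_whiskerRight] at e
            simp only [MonoidalCategory.whiskerLeft_comp, Category.assoc]
            rw [whisker_exchange_assoc, ← associator_naturality_middle_assoc, reassoc_of% e]
            monoidal

variable {X} in
/-- The active part: the tensor product of the morphisms induced by the restrictions of `f` to the
intervals between consecutive entries of `L`. -/
def active {m n : FinInt} (f : m ⟶ n) : (r s : ℕ) → ev f s = r → (L' L : List ℕ) →
    L.map (ev f) = L' → (pathTensor (simplices X) r L' ⟶ pathTensor (simplices X) s L)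
  | _, _, _, [], [], _ => 𝟙 _
  | r, s, h, t' :: L', t :: L, hL =>
    X.map (res f s t r t' h (List.cons.inj hL).1).op ⊗ₘ
      active f t' t (List.cons.inj hL).1 L' L (List.cons.inj hL).2
  | _, _, _, [], _ :: _, h => absurd h (by simp)
  | _, _, _, _ :: _, [], h => absurd h (by simp)

lemma active_id {m : FinInt} (s : ℕ) (h : ev (𝟙 m) s = s) (L : List ℕ)
    (hs : (s :: L).Pairwise (· ≤ ·)) (hL : L.map (ev (𝟙 m)) = L) :
    active (X := X) (𝟙 m) s s h L L hL = 𝟙 _ := by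
  induction L generalizing s with
  | nil => simp [active]
  | cons t L ih =>
    have e : res (𝟙 m) s t s t h (List.cons.inj hL).1 = 𝟙 _ := hom_ext fun i hi => by
      replace hi : i ≤ t - s := hi
      have h1 := (List.cons.inj hL).1
      have h2 := (List.pairwise_cons.1 hs).1 t (by simp)
      rw [ev_id] at h1
      rw [ev_res, ev_id, ev_id]
      change min (s + min i (t - s)) m.len - s = min i (t - s)
      omega
    rw [active, ih t _ (List.pairwise_cons.1 hs).2 _, e]
    simp

lemma active_comp {l m n : FinInt} (f : l ⟶ m) (g : m ⟶ n) (q r s : ℕ) (hf : ev f s = r)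
    (hg : ev g r = q) (h : ev (f ≫ g) s = q) (L'' L' L : List ℕ)
    (hs : (s :: L).Pairwise (· ≤ ·)) (hL : L.map (ev f) = L') (hL' : L'.map (ev g) = L'')
    (hL'' : L.map (ev (f ≫ g)) = L'') :
    active (X := X) g q r hg L'' L' hL' ≫ active (X := X) f r s hf L' L hL =
      active (X := X) (f ≫ g) q s h L'' L hL'' := by
  induction L generalizing q r s L' L'' with
  | nil =>
    obtain rfl : L' = [] := by simpa using hL.symm
    obtain rfl : L'' = [] := by simpa using hL'.symm
    simp [active]
  | cons t L ih =>
    cases L' with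
    | nil => simp at hL
    | cons t' L' =>
      cases L'' with
      | nil => simp at hL'
      | cons t'' L'' =>
        obtain ⟨ht', hL1⟩ := List.cons.inj hL
        obtain ⟨ht'', hL1'⟩ := List.cons.inj hL'
        obtain ⟨h5, hL1''⟩ := List.cons.inj hL''
        have h1 := (List.pairwise_cons.1 hs).1 t (by simp)
        have e : res f s t r t' hf ht' ≫ res g r t' q t'' hg ht'' =
            res (f ≫ g) s t q t'' h h5 := hom_ext fun i hi => by
          replace hi : i ≤ t - s := hi
          have h3 := ev_mono f (show s ≤ s + i by omega)
          have h4 := ev_mono f (show s + i ≤ t by omega)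
          simp only [ev_comp, ev_res, min_eq_left hi]
          rw [show r + min (ev f (s + i) - r) (t' - r) = ev f (s + i) by omega]
        rw [active, active, active, tensorHom_comp_tensorHom, ← X.map_comp, ← op_comp, e,
          ih _ _ _ _ _ h5 _ _ (List.pairwise_cons.1 hs).2 hL1 hL1' hL1'']

lemma active_refine {m n : FinInt} (f : m ⟶ n) (r s : ℕ) (h : ev f s = r)
    (M' M L' L : List ℕ) (hs : (s :: L).Pairwise (· ≤ ·)) (hs' : (r :: L').Pairwise (· ≤ ·))
    (hM : M.map (ev f) = M')
    (hL : L.map (ev f) = L') (hML : M.Sublist L) (hML' : M'.Sublist L') :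
    active (X := X) f r s h M' M hM ≫ refine X s M L hML =
      refine X r M' L' hML' ≫ active (X := X) f r s h L' L hL := by
  induction L generalizing r s M M' L' with
  | nil =>
    obtain rfl : M = [] := by simpa using hML
    obtain rfl : L' = [] := by simpa using hL.symm
    obtain rfl : M' = [] := by simpa using hML'
    simp [active, refine]
  | cons t L ih =>
    cases L' with
    | nil => simp at hL
    | cons t' L' =>
      obtain ⟨ht', hL1⟩ := List.cons.inj hL
      have hs2 := (List.pairwise_cons.1 hs).2
      have hs2' := (List.pairwise_cons.1 hs').2
      have hst := (List.pairwise_cons.1 hs).1 t (by simp)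
      cases M with
      | nil =>
        obtain rfl : M' = [] := by simpa using hM.symm
        have e := ih t' t ht' [] [] L' hs2 hs2' rfl hL1 (by simp) (by simp)
        simp only [active, Category.id_comp] at e
        rw [refine_nil, refine_nil, active, active, e, Category.id_comp, Category.assoc,
          tensorHom_comp_tensorHom, unitMap_map]
      | cons u M =>
        cases M' with
        | nil => simp at hM
        | cons u' M' =>
          obtain ⟨hu', hM1'⟩ := List.cons.inj hM
          by_cases hu : u = t
          · subst hu
            obtain rfl : u' = t' := by omega
            have hM1 : M.Sublist L := by simpa using hML
            have hM2 : M'.Sublist L' := by simpa using hML'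
            rw [refine_keep X s u hML hM1, refine_keep X r u' hML' hM2, active, active,
              ← id_tensorHom, ← id_tensorHom, tensorHom_comp_tensorHom, tensorHom_comp_tensorHom,
              ih _ _ ht' _ _ _ hs2 hs2' hM1' hL1 hM1 hM2, Category.comp_id, Category.id_comp]
          · have hM1 := sublist_of_ne hML hu
            have htu := (List.pairwise_cons.1 hs2).1 u (hM1.subset (by simp))
            have hM2 : (u' :: M').Sublist L' := by
              rw [← hM, ← hL1]
              exact hM1.map _
            have e1 : refine X r (u' :: M') (t' :: L') hML' =
                split X r t' u' ▷ pathTensor (simplices X) u' M' ≫ (α_ _ _ _).hom ≫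
                  simplices X (t' - r) ◁ refine X t' (u' :: M') L' hM2 := by
              by_cases hut' : u' = t'
              · subst hut'
                have hM3 : M'.Sublist L' := by simpa using hML'
                rw [refine_keep X r u' hML' hM3, ← ins_refine X u' L' hs2' M' hM2 hM3,
                  MonoidalCategory.whiskerLeft_comp, ← ins_cons_right, Category.assoc]
              · rw [refine_split X r hML' hM2 hut']
            have e2 := ih t' t ht' (u' :: M') (u :: M) L' hs2 hs2' hM hL1 hM1 hM2
            have e3 := split_nat X f hst htu h ht' hu'
            rw [refine_split X s hML hM1 hu, e1, active, active]
            rw [active] at e2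
            simp only [Category.assoc]
            rw [← id_tensorHom (simplices X (t' - r)), tensorHom_comp_tensorHom, Category.id_comp,
              ← e2]
            rw [← Category.comp_id (X.map (res f s t r t' h ht').op), ← tensorHom_comp_tensorHom,
              ← associator_naturality_assoc, ← tensorHom_id, ← tensorHom_id,
              tensorHom_comp_tensorHom_assoc, tensorHom_comp_tensorHom_assoc, e3, id_tensorHom,
              Category.comp_id, Category.id_comp]

end Paths

/-- A necklace, given by its last vertex `p` and its set of joints `T`, where
`{0, p} ⊆ T ⊆ {0, …, p}`. Its beads are the intervals between consecutive joints. -/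
@[ext]
structure Necklace where
  last : ℕ
  joints : Finset ℕ
  zero_mem : 0 ∈ joints
  last_mem : last ∈ joints
  le_last : ∀ t ∈ joints, t ≤ last

namespace Necklace

/-- The interval of vertices of a necklace. -/
abbrev vertices (T : Necklace) : FinInt := ⟨T.last⟩

/-- A necklace map `(T, p) → (U, q)` is an endpoint preserving order morphism `f : [p] → [q]` with
`U ⊆ f(T)`. -/
@[ext]
structure Hom (T U : Necklace) where
  toHom : T.vertices ⟶ U.vertices
  joints_subset : U.joints ⊆ T.joints.image (FinInt.ev toHom)

lemma image_id (T : Necklace) (A : Finset ℕ) (hA : ∀ t ∈ A, t ≤ T.last) :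
    A.image (FinInt.ev (𝟙 T.vertices)) = A := by
  ext x
  simp only [Finset.mem_image, FinInt.ev_id]
  constructor
  · rintro ⟨y, hy, rfl⟩
    rwa [min_eq_left (hA y hy)]
  · exact fun hx => ⟨x, hx, min_eq_left (hA x hx)⟩

lemma image_comp {T U R : FinInt} (f : T ⟶ U) (g : U ⟶ R) (A : Finset ℕ) :
    A.image (FinInt.ev (f ≫ g)) = (A.image (FinInt.ev f)).image (FinInt.ev g) := by
  rw [Finset.image_image]
  congr 1
  funext x
  exact FinInt.ev_comp f g x

instance : Category Necklace where
  Hom := Hom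
  id T := ⟨𝟙 _, by rw [image_id _ _ T.le_last]⟩
  comp f g := ⟨f.toHom ≫ g.toHom, by
    rw [image_comp]
    exact g.joints_subset.trans (Finset.image_subset_image f.joints_subset)⟩

lemma id_toHom (T : Necklace) : Hom.toHom (𝟙 T) = 𝟙 _ := rfl
lemma comp_toHom {T U R : Necklace} (f : T ⟶ U) (g : U ⟶ R) :
    Hom.toHom (f ≫ g) = f.toHom ≫ g.toHom := rfl

lemma hom_ext {T U : Necklace} {f g : T ⟶ U} (h : f.toHom = g.toHom) : f = g := Hom.ext h

/-- The joints of a necklace other than `0`, in increasing order. -/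
def jointList (T : Necklace) : List ℕ := (T.joints.erase 0).sort (· ≤ ·)

lemma mem_jointList {T : Necklace} {t : ℕ} : t ∈ T.jointList ↔ t ≠ 0 ∧ t ∈ T.joints := by
  simp [jointList]

lemma pairwise_jointList (T : Necklace) : (0 :: T.jointList).Pairwise (· ≤ ·) := by
  refine List.pairwise_cons.2 ⟨fun _ _ => Nat.zero_le _, ?_⟩
  exact Finset.pairwise_sort _ _

lemma pairwise_map {m n : FinInt} (f : m ⟶ n) {L : List ℕ} (hL : (0 :: L).Pairwise (· ≤ ·)) :
    (0 :: L.map (FinInt.ev f)).Pairwise (· ≤ ·) := by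
  refine List.pairwise_cons.2 ⟨fun _ _ => Nat.zero_le _, ?_⟩
  exact List.Pairwise.map _ (fun a b h => FinInt.ev_mono f h) (List.pairwise_cons.1 hL).2

lemma sublist_map {T U : Necklace} (f : T ⟶ U) :
    U.jointList.Sublist (T.jointList.map (FinInt.ev f.toHom)) := by
  refine List.sublist_of_subperm_of_pairwise (r := (· ≤ ·)) ?_
    (List.pairwise_cons.1 U.pairwise_jointList).2
    (List.pairwise_cons.1 (pairwise_map f.toHom T.pairwise_jointList)).2
  refine List.Nodup.subperm (Finset.sort_nodup _ _) fun u hu => ?_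
  obtain ⟨hu0, hu⟩ := mem_jointList.1 hu
  obtain ⟨t, ht, rfl⟩ := Finset.mem_image.1 (f.joints_subset hu)
  refine List.mem_map.2 ⟨t, mem_jointList.2 ⟨?_, ht⟩, rfl⟩
  rintro rfl
  exact hu0 (FinInt.ev_zero _)

lemma map_id_jointList (T : Necklace) :
    T.jointList.map (FinInt.ev (𝟙 T.vertices)) = T.jointList := by
  conv_rhs => rw [← List.map_id T.jointList]
  refine List.map_congr_left fun t ht => ?_
  rw [FinInt.ev_id, min_eq_left (T.le_last t (mem_jointList.1 ht).2)]
  rfl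

section

variable {W : Type*} [Category* W] [MonoidalCategory W]

/-- For a necklace `T = {0 = t₀ < t₁ < … < tₖ}` and objects `A n`, the tensor product
`A (t₁ - t₀) ⊗ A (t₂ - t₁) ⊗ … ⊗ A (tₖ - tₖ₋₁)`, which is the unit if `k = 0`. -/
abbrev tensorBeads (A : ℕ → W) (T : Necklace) : W := pathTensor A 0 T.jointList

variable (X : FinIntᵒᵖ ⥤ W) [X.OplaxMonoidal] [IsIso (Functor.OplaxMonoidal.η X)]

lemma refine_active_congr {m n : FinInt} (f : m ⟶ n) (h0 : FinInt.ev f 0 = 0) {M L L₁ L₂ : List ℕ}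
    (e : L₁ = L₂) (h₂ : M.Sublist L₂) (hL₂ : L.map (FinInt.ev f) = L₂)
    {h₁ : M.Sublist L₁} {hL₁ : L.map (FinInt.ev f) = L₁} :
    refine X 0 M L₁ h₁ ≫ active (X := X) f 0 0 h0 L₁ L hL₁ =
      refine X 0 M L₂ h₂ ≫ active (X := X) f 0 0 h0 L₂ L hL₂ := by
  subst e
  rfl

/-- The functor `T ↦ X_T` on necklaces. For a necklace map `f : T → U`, the morphism `X_U → X_T` is
the composite of the inert part `X_U → X_{f(T)}`, given by comultiplications, with the active part
`X_{f(T)} → X_T`, given by the restrictions of `f` to the beads of `T`. -/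
def necklaceFunctor : Necklaceᵒᵖ ⥤ W where
  obj T := tensorBeads (simplices X) T.unop
  map {U T} f :=
    refine X 0 U.unop.jointList (T.unop.jointList.map (FinInt.ev f.unop.toHom))
      (sublist_map f.unop) ≫
    active (X := X) f.unop.toHom 0 0 (FinInt.ev_zero _) _ T.unop.jointList rfl
  map_id T := by
    refine (refine_active_congr X (𝟙 T.unop.vertices) _ (map_id_jointList T.unop)
      (List.Sublist.refl _) (map_id_jointList T.unop)).trans ?_
    rw [refine_self, active_id X _ _ _ T.unop.pairwise_jointList, Category.id_comp]
  map_comp {V U T} g f := by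
    have hT := T.unop.pairwise_jointList
    have e : T.unop.jointList.map (FinInt.ev (f.unop.toHom ≫ g.unop.toHom)) =
        (T.unop.jointList.map (FinInt.ev f.unop.toHom)).map (FinInt.ev g.unop.toHom) := by
      rw [List.map_map]
      exact List.map_congr_left fun t _ => FinInt.ev_comp _ _ _
    refine (refine_active_congr X (f.unop.toHom ≫ g.unop.toHom) _ e
      ((sublist_map g.unop).trans ((sublist_map f.unop).map _)) e).trans ?_
    rw [← active_comp X f.unop.toHom g.unop.toHom 0 0 0 (FinInt.ev_zero _) (FinInt.ev_zero _)
      (FinInt.ev_zero _) _ _ _ hT rfl rfl e, Category.assoc,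
      ← refine_comp X 0 _ _ _ (pairwise_map _ (pairwise_map _ hT)) (sublist_map g.unop)
        ((sublist_map f.unop).map _), Category.assoc,
      ← reassoc_of% (active_refine X g.unop.toHom 0 0 (FinInt.ev_zero _) _ _ _ _
        (pairwise_map f.unop.toHom hT) (pairwise_map _ (pairwise_map _ hT)) rfl rfl
        (sublist_map f.unop) ((sublist_map f.unop).map _))]

end

end Necklace

/-! ### Templicial objects -/

/-- A templicial object in `V` with set of vertices `S`: a strongly unital colax monoidal functor
from the opposite of the category of finite intervals to the `V`-enriched quivers on `S`. -/
structure TemplicialObject (V : Type u) [Category.{v} V] [MonoidalCategory V] [SymmetricCategory V]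
    [MonoidalClosed V] [HasColimits V] (S : Type v) where
  functor : FinIntᵒᵖ ⥤ VQuiv V S
  [colax : functor.OplaxMonoidal]
  [unital : IsIso (Functor.OplaxMonoidal.η functor)]

attribute [instance] TemplicialObject.colax TemplicialObject.unital

/-! ### Degenerate simplices -/

/-- The surjective order morphisms `[m] → [n]`. They automatically preserve the endpoints. -/
def surjective : MorphismProperty FinInt := fun _ _ f => Function.Surjective f.toOrderHom

instance : surjective.IsMultiplicative where
  id_mem _ := Function.surjective_id
  comp_mem _ _ hf hg := hg.comp hf

/-- The category of the `[n]` with the surjective order morphisms. -/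
abbrev SimplexSurj := WideSubcategory surjective

/-- The category of surjections `σ : [n] → [k]` with `k < n`. -/
abbrev ProperQuotient (n : SimplexSurj) :=
  ObjectProperty.FullSubcategory fun σ : Under n => σ.right.obj.len < n.obj.len

section Degenerate

variable {W : Type*} [Category* W] [HasColimitsOfSize.{0, 0} W] (Y : SimplexSurjᵒᵖ ⥤ W)

/-- The diagram `(σ : [n] → [k]) ↦ Y_k`. -/
abbrev degenerateDiagram (n : SimplexSurj) : (ProperQuotient n)ᵒᵖ ⥤ W :=
  (ObjectProperty.ι _ ⋙ Under.forget n).op ⋙ Y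

/-- `Y_n^deg`, the colimit of `Y_k` over the surjections `[n] → [k]` with `k < n`. -/
def degenerate (n : SimplexSurj) : W := colimit (degenerateDiagram Y n)

/-- The canonical morphism `Y_n^deg → Y_n`. -/
def degenerateMap (n : SimplexSurj) : degenerate Y n ⟶ Y.obj (op n) :=
  colimit.desc (degenerateDiagram Y n)
    { pt := Y.obj (op n)
      ι :=
        { app := fun σ => Y.map σ.unop.obj.hom.op
          naturality := fun σ τ f => by
            have h := Under.w f.unop.hom
            change Y.map f.unop.hom.right.op ≫ Y.map τ.unop.obj.hom.op =
              Y.map σ.unop.obj.hom.op ≫ 𝟙 _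
            rw [Category.comp_id, ← Y.map_comp, ← op_comp, h] } }

end Degenerate

/-! ### Flags -/

namespace Necklace

/-- The poset `P_T` of the subsets `U` of `[p]` with `T ⊆ U`, ordered by inclusion. -/
abbrev Poset (T : Necklace) := { U : Finset ℕ // T.joints ⊆ U ∧ ∀ u ∈ U, u ≤ T.last }

/-- The functor `T ↦ P_T`, sending a necklace map `f` to `U ↦ f(U)`. -/
def posetFunctor : Necklace ⥤ PartOrd.{0} where
  obj T := PartOrd.of T.Poset
  map {T U} f := PartOrd.ofHom
    { toFun A := ⟨A.1.image (FinInt.ev f.toHom),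
        f.joints_subset.trans (Finset.image_subset_image A.2.1), fun u hu => by
          obtain ⟨t, _, rfl⟩ := Finset.mem_image.1 hu
          exact FinInt.ev_le _ _⟩
      monotone' := fun A B h => Finset.image_subset_image h }
  map_id T := by
    refine PartOrd.ext fun A => ?_
    exact Subtype.ext (image_id T A.1 A.2.2)
  map_comp f g := by
    refine PartOrd.ext fun A => ?_
    exact Subtype.ext (image_comp f.toHom g.toHom A.1)

/-- The functor `T ↦ N(P_T)`. The `n`-simplices of `N(P_T)` are the flags of length `n` on `T`. -/
def flags : Necklace ⥤ SSet.{0} := posetFunctor ⋙ PartOrd.nerveFunctor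

end Necklace

/-- A necklace `T` with a flanked flag of length `n`, that is a sequence `T₀ ⊆ … ⊆ Tₙ` with
`T₀ = T` and `Tₙ = [p]`. -/
structure FlankedFlag (n : ℕ) where
  necklace : Necklace
  flag : ComposableArrows necklace.Poset n
  first : (flag.obj 0).1 = necklace.joints
  last : (flag.obj (Fin.last n)).1 = Finset.range (necklace.last + 1)

/-! ### Categorification -/

section Categorification

variable (V : Type u) [Category.{v} V] [MonoidalCategory V] [HasColimits V]

/-- The functor `F : Set → V` sending a set to a coproduct of copies of `I`. -/
def free : Type ⥤ V := sigmaConst.obj (𝟙_ V)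

/-- The functor `T ↦ F N(P_T)`. -/
def freeFlags : Necklace ⥤ SimplicialObject V :=
  Necklace.flags ⋙ (SimplicialObject.whiskering (Type) V).obj (free V)

/-- The tensoring of simplicial objects over `V`, given by `(A · Y)_n = A ⊗ Y_n`. -/
def tensoring : V ⥤ SimplicialObject V ⥤ SimplicialObject V :=
  curriedTensor V ⋙ SimplicialObject.whiskering V V

variable {V}

/-- The weighted colimit of `G` with weight `Y`, as the coequaliser of
`∐_{f : T → U} Y_U · G_T ⇉ ∐_T Y_T · G_T`. -/
def weightedColimit (Y : Necklaceᵒᵖ ⥤ V) (G : Necklace ⥤ SimplicialObject V) : SimplicialObject V :=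
  coequalizer
    (Sigma.desc fun f : Σ T U : Necklace, T ⟶ U =>
      ((tensoring V).map (Y.map f.2.2.op)).app (G.obj f.1) ≫
        Sigma.ι (fun T : Necklace => ((tensoring V).obj (Y.obj (op T))).obj (G.obj T)) f.1)
    (Sigma.desc fun f : Σ T U : Necklace, T ⟶ U =>
      ((tensoring V).obj (Y.obj (op f.2.1))).map (G.map f.2.2) ≫
        Sigma.ι (fun T : Necklace => ((tensoring V).obj (Y.obj (op T))).obj (G.obj T)) f.2.1)

end Categorification

namespace TemplicialObject

variable {V : Type u} [Category.{v} V] [MonoidalCategory V] [SymmetricCategory V]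
  [MonoidalClosed V] [HasColimits V] {S : Type v} (X : TemplicialObject V S)

/-- The quiver `X_n`. -/
abbrev obj (n : ℕ) : VQuiv V S := X.functor.obj (op ⟨n⟩)

/-- The restriction of `X` to surjective morphisms. -/
def restrict : SimplexSurjᵒᵖ ⥤ VQuiv V S := (wideSubcategoryInclusion surjective).op ⋙ X.functor

/-- The canonical morphism `X_n^deg → X_n` from the quiver of degenerate `n`-simplices. -/
def degMap (n : ℕ) : degenerate X.restrict ⟨⟨n⟩⟩ ⟶ X.obj n := degenerateMap X.restrict ⟨⟨n⟩⟩

/-- `X` has non-degenerate simplices: for every `n` there is a quiver `X_n^nd` such that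
`X_n^deg → X_n` is, up to isomorphism, the coprojection `X_n^deg → X_n^deg ⨿ X_n^nd`. The quivers
`X_n^nd`, together with the complementary coprojections, are part of the data. -/
structure NonDegenerate where
  nd : ℕ → VQuiv V S
  incl : ∀ n, nd n ⟶ X.obj n
  isColimit : ∀ n, Nonempty (IsColimit (BinaryCofan.mk (X.degMap n) (incl n)))

/-- The functor `T ↦ X_T(a, b)` on necklaces. -/
def nec (a b : S) : Necklaceᵒᵖ ⥤ V := Necklace.necklaceFunctor X.functor ⋙ VQuiv.eval V a b

/-- The simplicial hom-object of the categorification of `X` from `a` to `b`: the weighted colimit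
of `T ↦ F N(P_T)` with weight `T ↦ X_T(a, b)`. -/
def categorification (a b : S) : SimplicialObject V := weightedColimit (X.nec a b) (freeFlags V)

/-- `X_T^nd = X_{t₁}^nd ⊗ X_{t₂ - t₁}^nd ⊗ … ⊗ X_{p - tₖ₋₁}^nd`. -/
def NonDegenerate.ndNecklace {X : TemplicialObject V S} (N : X.NonDegenerate) (T : Necklace) :
    VQuiv V S :=
  Necklace.tensorBeads N.nd T

end TemplicialObject

end Templicial

end

/-!
Call a presheaf `Y` on `J` free on objects `nd j` mapping to `Y j` if every `Y j` is the coproduct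
of the `nd k` over the arrows `j ⟶ k`. The colimit of a free presheaf is the coproduct of all
`nd j`, since a family of morphisms `nd j ⟶ Z` is the same as a cocone under `Y`.

By induction on the dimension, as in the Eilenberg–Zilber lemma, `X` restricted to the surjections
of finite intervals is free on the `X_n^nd`. As `⊗` preserves coproducts in both variables, it
follows that `T ↦ X_T` restricted to the active surjections, that is the maps `f : T ⟶ U` that are
surjective with `f(T) = U`, is free on the `X_T^nd`.

The `n`-simplices of `ℭ[X](a, b)` are the colimit of `X_T(a, b)` over the category of pairs of a
necklace `T` and a flag `T₀ ⊆ … ⊆ Tₙ` on `T`. Restricting the vertices to `Tₙ` and taking `T₀` as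
the set of joints makes the flag flanked, and this is a coreflection. Hence the colimit may be taken
over flanked flags. The maps between flanked flags are exactly the active surjections, and each one
is determined by its source and the underlying active surjection, so the presheaf `X_T(a, b)`
remains free when pulled back to flanked flags.
-/

noncomputable section

namespace Templicial

open FinInt

/-! ### Coproducts -/

section IsCoproduct

variable {C : Type*} [Category* C]

/-- The morphisms `ι i : A i ⟶ B` exhibit `B` as the coproduct of the objects `A i`. -/
def IsCoproduct {I : Type*} {A : I → C} {B : C} (ι : ∀ i, A i ⟶ B) : Prop :=
  Nonempty (IsColimit (Cofan.mk B ι))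

namespace IsCoproduct

variable {I : Type*} {A : I → C} {B : C} {ι : ∀ i, A i ⟶ B}

lemma hom_ext (h : IsCoproduct ι) {Z : C} {f g : B ⟶ Z} (hfg : ∀ i, ι i ≫ f = ι i ≫ g) : f = g :=
  Cofan.IsColimit.hom_ext h.some f g hfg

lemma exists_desc (h : IsCoproduct ι) {Z : C} (φ : ∀ i, A i ⟶ Z) :
    ∃ d : B ⟶ Z, ∀ i, ι i ≫ d = φ i :=
  ⟨Cofan.IsColimit.desc h.some φ, Cofan.IsColimit.fac h.some φ⟩

lemma of_exists_desc (hom_ext : ∀ {Z : C} {f g : B ⟶ Z}, (∀ i, ι i ≫ f = ι i ≫ g) → f = g)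
    (exists_desc : ∀ {Z : C} (φ : ∀ i, A i ⟶ Z), ∃ d : B ⟶ Z, ∀ i, ι i ≫ d = φ i) :
    IsCoproduct ι := by
  choose d hd using @exists_desc
  exact ⟨Cofan.IsColimit.mk _ (fun s => d s.inj) (fun s => hd s.inj)
    fun s _ hm => hom_ext fun i => (hm i).trans (hd s.inj i).symm⟩

lemma isIso_of_unique [Unique I] (h : IsCoproduct ι) : IsIso (ι default) := by
  obtain ⟨d, hd⟩ := h.exists_desc fun i => eqToHom (congrArg A (Subsingleton.elim i default))
  refine ⟨d, hd default, h.hom_ext fun i => ?_⟩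
  obtain rfl := Subsingleton.elim i default
  simp [reassoc_of% hd default]

lemma of_unique [Unique I] [IsIso (ι default)] : IsCoproduct ι := by
  refine .of_exists_desc (fun hfg => (cancel_epi _).1 (hfg default)) fun φ => ?_
  refine ⟨inv (ι default) ≫ φ default, fun i => ?_⟩
  obtain rfl := Subsingleton.elim i default
  simp

lemma reindex_iff {J : Type*} {e : J → I} (he : Function.Bijective e) :
    IsCoproduct (fun j => ι (e j)) ↔ IsCoproduct ι :=
  (Cofan.isColimitEquivOfEquiv (Equiv.ofBijective e he) (Cofan.mk B ι)).nonempty_congr.symm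

lemma reindex (h : IsCoproduct ι) {J : Type*} {e : J → I} (he : Function.Bijective e) :
    IsCoproduct fun j => ι (e j) :=
  (reindex_iff he).2 h

lemma of_iso (h : IsCoproduct ι) {A' : I → C} {ι' : ∀ i, A' i ⟶ B} (e : ∀ i, A' i ≅ A i)
    (he : ∀ i, (e i).hom ≫ ι i = ι' i) : IsCoproduct ι' :=
  of_exists_desc
    (fun hfg => h.hom_ext fun i => by simpa [← he, cancel_epi] using hfg i)
    fun φ => (h.exists_desc fun i => (e i).inv ≫ φ i).imp fun d hd i => by simp [← he, hd]

lemma map {D : Type*} [Category* D] (F : C ⥤ D) (h : IsCoproduct ι)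
    [PreservesColimit (Discrete.functor A) F] : IsCoproduct fun i => F.map (ι i) :=
  Nonempty.map (isColimitCofanMkObjOfIsColimit F A ι) h

lemma sigma (h : IsCoproduct ι) {J : I → Type*} {A' : ∀ i, J i → C} {κ : ∀ i j, A' i j ⟶ A i}
    (h' : ∀ i, IsCoproduct (κ i)) : IsCoproduct fun p : Σ i, J i => κ p.1 p.2 ≫ ι p.1 :=
  ⟨Cofan.isColimitTrans _ h.some κ fun i => (h' i).some⟩

section Monoidal

variable [MonoidalCategory C] [MonoidalClosed C]

lemma whiskerLeft (h : IsCoproduct ι) (R : C) : IsCoproduct fun i => R ◁ ι i :=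
  h.map (tensorLeft R)

variable [SymmetricCategory C]

lemma whiskerRight (h : IsCoproduct ι) (R : C) : IsCoproduct fun i => ι i ▷ R :=
  have : PreservesColimit (Discrete.functor A) (tensorRight R) :=
    preservesColimit_of_natIso _ (BraidedCategory.tensorLeftIsoTensorRight R)
  h.map (tensorRight R)

lemma tensor (h : IsCoproduct ι) {J : Type*} {A' : J → C} {B' : C} {κ : ∀ j, A' j ⟶ B'}
    (h' : IsCoproduct κ) : IsCoproduct fun p : I × J => ι p.1 ⊗ₘ κ p.2 := by
  simp only [tensorHom_def']
  exact ((h.whiskerRight B').sigma fun i => h'.whiskerLeft (A i)).reindex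
    (Equiv.sigmaEquivProd I J).symm.bijective

end Monoidal

end IsCoproduct

end IsCoproduct

namespace VQuiv

variable {V : Type u} [Category.{v} V] {S : Type v}

lemma isCoproduct_app {I : Type*} [HasCoproductsOfShape I V] {A : I → VQuiv V S} {B : VQuiv V S}
    {ι : ∀ i, A i ⟶ B} (h : IsCoproduct ι) (a b : S) : IsCoproduct fun i => (ι i).app a b :=
  have : PreservesColimit (Discrete.functor A) (eval V a b) :=
    preservesColimit_of_preserves_colimit_cocone (colimitCocone (Discrete.functor A)).isColimit
      (colimit.isColimit (Discrete.functor A ⋙ eval V a b))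
  h.map (eval V a b)

lemma isCoproduct_of_app {I : Type*} {A : I → VQuiv V S} {B : VQuiv V S}
    {ι : ∀ i, A i ⟶ B} (h : ∀ a b, IsCoproduct fun i => (ι i).app a b) : IsCoproduct ι := by
  refine .of_exists_desc (fun {Z f g} hfg => ?_) fun {Z} φ => ?_
  · ext a b
    exact (h a b).hom_ext fun i => congrArg (fun f => Hom.app f a b) (hfg i)
  · choose d hd using fun a b => (h a b).exists_desc fun i => (φ i).app a b
    exact ⟨⟨d⟩, fun i => hom_ext fun a b => hd a b i⟩

variable [MonoidalCategory V] [SymmetricCategory V] [MonoidalClosed V] [HasColimits V]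

lemma isCoproduct_tinc (P Q : VQuiv V S) (a b : S) :
    IsCoproduct fun c => tinc P Q a c b :=
  ⟨coproductIsCoproduct _⟩

lemma isCoproduct_tensor {I J : Type*} [HasCoproductsOfShape I V] [HasCoproductsOfShape J V]
    {P : I → VQuiv V S} {P' : VQuiv V S} {Q : J → VQuiv V S} {Q' : VQuiv V S}
    {ι : ∀ i, P i ⟶ P'} {κ : ∀ j, Q j ⟶ Q'} (h : IsCoproduct ι) (h' : IsCoproduct κ) :
    IsCoproduct fun p : I × J => ι p.1 ⊗ₘ κ p.2 := by
  have H (a b c : S) := (isCoproduct_app h a c).tensor (isCoproduct_app h' c b)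
  refine isCoproduct_of_app fun a b => .of_exists_desc
    (fun {Z f g} hfg => tinc_ext fun c => (H a b c).hom_ext fun p => ?_) fun {Z} φ => ?_
  · simpa only [tinc_tensorHom_assoc] using tinc _ _ a c b ≫= hfg p
  · choose d hd using fun c => (H a b c).exists_desc fun p => tinc (P p.1) (Q p.2) a c b ≫ φ p
    obtain ⟨d', hd'⟩ := (isCoproduct_tinc P' Q' a b).exists_desc d
    exact ⟨d', fun p => tinc_ext fun c => by rw [tinc_tensorHom_assoc, hd', hd]⟩

end VQuiv

/-! ### Free presheaves -/

section IsFreeOn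

variable {J K C : Type*} [Category* J] [Category* K] [Category* C]

/-- The presheaf `Y` is free on the morphisms `incl j : nd j ⟶ Y j`: every `Y j` is the coproduct of
the objects `nd k` over all arrows `j ⟶ k`. This expresses that `Y` is the left Kan extension of
the family `nd` from the discrete category on the objects of `J`. -/
def IsFreeOn (Y : Jᵒᵖ ⥤ C) {nd : J → C} (incl : ∀ j, nd j ⟶ Y.obj (op j)) : Prop :=
  ∀ j, IsCoproduct fun f : Σ k, j ⟶ k => incl f.1 ≫ Y.map f.2.op

/-- Every arrow out of `p.obj j` is the image of a unique arrow out of `j`. -/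
def IsDiscreteOpfibration (p : J ⥤ K) : Prop :=
  ∀ j, Function.Bijective fun f : Σ k, j ⟶ k => (⟨p.obj f.1, p.map f.2⟩ : Σ k, p.obj j ⟶ k)

namespace IsFreeOn

variable {Y : Jᵒᵖ ⥤ C} {nd : J → C} {incl : ∀ j, nd j ⟶ Y.obj (op j)}

lemma isCoproduct_isColimit (h : IsFreeOn Y incl) {c : Cocone Y} (hc : IsColimit c) :
    IsCoproduct fun j => incl j ≫ c.ι.app (op j) := by
  refine .of_exists_desc (fun hfg => hc.hom_ext fun j => (h j.unop).hom_ext fun f => ?_)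
    fun {Z} φ => ?_
  · simpa using hfg f.1
  choose d hd using fun j => (h j).exists_desc fun f => φ f.1
  have hd_id (j : J) : incl j ≫ d j = φ j := by simpa using hd j ⟨j, 𝟙 j⟩
  have d_nat {j k : J} (f : j ⟶ k) : Y.map f.op ≫ d j = d k := (h k).hom_ext fun g => by
    simpa [hd] using hd j ⟨g.1, f ≫ g.2⟩
  let s : Cocone Y :=
    { pt := Z
      ι := { app j := d j.unop, naturality _ _ f := by simpa using d_nat f.unop } }
  exact ⟨hc.desc s, fun j => by simp [s, hd_id]⟩

lemma comp_op {p : K ⥤ J} (h : IsFreeOn Y incl) (hp : IsDiscreteOpfibration p) :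
    IsFreeOn (p.op ⋙ Y) fun k => incl (p.obj k) := fun k =>
  (h (p.obj k)).reindex (hp k)

end IsFreeOn

end IsFreeOn

/-! ### Simplices as coproducts of non-degenerate simplices -/

lemma IsCoproduct.of_binaryCofan {C : Type*} [Category* C] {I : Type*} {A : Option I → C} {B D : C}
    {ι : ∀ i, A i ⟶ B} {inl : D ⟶ B} (h : IsColimit (BinaryCofan.mk inl (ι none)))
    {ι' : ∀ i, A (some i) ⟶ D} (h' : IsCoproduct ι') (hι : ∀ i, ι' i ≫ inl = ι (some i)) :
    IsCoproduct ι := by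
  refine .of_exists_desc (fun {Z f g} hfg => ?_) fun φ => ?_
  · refine BinaryCofan.IsColimit.hom_ext h (h'.hom_ext fun i => ?_) (hfg none)
    have := hfg (some i)
    rwa [← hι, Category.assoc, Category.assoc] at this
  · obtain ⟨d, hd⟩ := h'.exists_desc fun i => φ (some i)
    obtain ⟨d' : B ⟶ _, hl : inl ≫ d' = d, hr⟩ := BinaryCofan.IsColimit.desc' h d (φ none)
    refine ⟨d', fun i => ?_⟩
    cases i with
    | none => exact hr
    | some i => rw [← hι, Category.assoc, hl, hd]

namespace FinInt

lemma exists_ev_of_surjective {m n : FinInt} {f : m ⟶ n} (hf : surjective f) {j : ℕ}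
    (hj : j ≤ n.len) : ∃ i ≤ m.len, ev f i = j := by
  obtain ⟨i, hi⟩ := hf ⟨j, by omega⟩
  exact ⟨i, by omega, by rw [ev_fin, hi]⟩

lemma surjective_of_exists_ev {m n : FinInt} {f : m ⟶ n} (hf : ∀ j ≤ n.len, ∃ i, ev f i = j) :
    surjective f := fun j => by
  obtain ⟨i, hi⟩ := hf j (by omega)
  exact ⟨_, Fin.ext hi⟩

lemma len_le_of_surjective {m n : FinInt} {f : m ⟶ n} (hf : surjective f) : n.len ≤ m.len := by
  simpa using Fintype.card_le_of_surjective _ hf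

lemma eq_id_of_surjective {m : FinInt} {f : m ⟶ m} (hf : surjective f) : f = 𝟙 m := by
  have h : StrictMono f.toOrderHom :=
    f.toOrderHom.monotone.strictMono_of_injective (Finite.injective_iff_surjective.2 hf)
  refine Hom.ext (OrderHom.ext _ _ (funext fun i => ?_))
  exact DFunLike.congr_fun
    (Subsingleton.elim (StrictMono.orderIsoOfSurjective f.toOrderHom h hf) (OrderIso.refl _)) i

end FinInt

namespace SimplexSurj

lemma eq_id_of_len_le {n k : SimplexSurj} (σ : n ⟶ k) (h : n.obj.len ≤ k.obj.len) :
    (⟨k, σ⟩ : Σ k, n ⟶ k) = ⟨n, 𝟙 n⟩ := by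
  obtain rfl : k = n := WideSubcategory.ext
    (FinInt.ext (le_antisymm (FinInt.len_le_of_surjective σ.property) h))
  obtain rfl : σ = 𝟙 k := WideSubcategory.hom_ext _ (FinInt.eq_id_of_surjective σ.property)
  rfl

lemma bijective_option_properQuotient (n : SimplexSurj) :
    Function.Bijective fun σ : Option (ProperQuotient n) =>
      σ.elim (⟨n, 𝟙 n⟩ : Σ k, n ⟶ k) fun σ => ⟨σ.obj.right, σ.obj.hom⟩ := by
  constructor
  · have hn (σ : ProperQuotient n) : (⟨n, 𝟙 n⟩ : Σ k, n ⟶ k) ≠ ⟨σ.obj.right, σ.obj.hom⟩ :=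
      fun h => σ.property.ne (congrArg (fun τ => τ.1.obj.len) h).symm
    rintro (_ | ⟨⟨⟨⟨⟩⟩, k, σ⟩, hσ⟩) (_ | ⟨⟨⟨⟨⟩⟩, l, τ⟩, hτ⟩) h
    · rfl
    · exact absurd h (hn _)
    · exact absurd h.symm (hn _)
    · cases h
      rfl
  · rintro ⟨k, σ⟩
    by_cases h : k.obj.len < n.obj.len
    · exact ⟨some ⟨Under.mk σ, h⟩, rfl⟩
    · exact ⟨none, (eq_id_of_len_le σ (not_lt.1 h)).symm⟩

lemma isDiscreteOpfibration_properQuotient (n : SimplexSurj) :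
    IsDiscreteOpfibration
      (ObjectProperty.ι (fun σ : Under n => σ.right.obj.len < n.obj.len) ⋙ Under.forget n) := by
  refine fun σ => ⟨?_, ?_⟩
  · rintro ⟨⟨⟨⟨⟨⟩⟩, k, τ⟩, hτ⟩, ⟨f⟩⟩ ⟨⟨⟨⟨⟨⟩⟩, l, ρ⟩, hρ⟩, ⟨g⟩⟩ h
    obtain ⟨hkl : k = l, h⟩ := Sigma.mk.inj_iff.1 h
    subst hkl
    have h : f.right = g.right := eq_of_heq h
    obtain rfl : τ = ρ := (Under.w f).symm.trans (h ▸ Under.w g)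
    obtain rfl : f = g := Under.UnderMorphism.ext h
    rfl
  · rintro ⟨k, τ⟩
    have hk : k.obj.len < n.obj.len :=
      (FinInt.len_le_of_surjective τ.property).trans_lt σ.property
    exact ⟨⟨⟨Under.mk (σ.obj.hom ≫ τ), hk⟩, ObjectProperty.homMk (Under.homMk τ)⟩, rfl⟩

end SimplexSurj

section Degenerate

variable {W : Type*} [Category* W] [HasColimitsOfSize.{0, 0} W]

lemma isFreeOn_of_isColimit_degenerateMap {Y : SimplexSurjᵒᵖ ⥤ W} {nd : SimplexSurj → W}
    {incl : ∀ n, nd n ⟶ Y.obj (op n)}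
    (h : ∀ n, Nonempty (IsColimit (BinaryCofan.mk (degenerateMap Y n) (incl n)))) :
    IsFreeOn Y incl := by
  intro n
  induction hn : n.obj.len using Nat.strong_induction_on generalizing n with
  | _ m ih =>
  subst hn
  have hdeg : IsFreeOn (degenerateDiagram Y n) fun σ => incl σ.obj.right := fun σ =>
    (ih _ σ.property σ.obj.right rfl).reindex
      (SimplexSurj.isDiscreteOpfibration_properQuotient n σ)
  have hcoprod := hdeg.isCoproduct_isColimit (colimit.isColimit (degenerateDiagram Y n))
  refine (IsCoproduct.reindex_iff (SimplexSurj.bijective_option_properQuotient n)).1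
    (.of_binaryCofan (inl := degenerateMap Y n) ?_ hcoprod fun σ => ?_)
  · simpa using (h n).some
  · exact (Category.assoc _ _ _).trans (incl σ.obj.right ≫= colimit.ι_desc _ (op σ))

end Degenerate

/-! ### Quotients of necklaces -/

/-- The surjections out of `[n]`. -/
abbrev SimplexQuotient (n : ℕ) := Σ k : SimplexSurj, (⟨⟨n⟩⟩ : SimplexSurj) ⟶ k

lemma FinInt.surjective_res {m n : FinInt} {f : m ⟶ n} (hf : surjective f) (s t : ℕ) :
    surjective (res f s t _ _ rfl rfl) := surjective_of_exists_ev fun j hj => by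
  replace hj : j ≤ ev f t - ev f s := hj
  rcases Nat.eq_zero_or_pos j with rfl | hj0
  · exact ⟨0, ev_zero _⟩
  · obtain ⟨i, -, hi⟩ := exists_ev_of_surjective hf
      (show ev f s + j ≤ n.len by have := ev_le f t; omega)
    have hsi : s < i := (ev_mono f).reflect_lt (by omega)
    have hst : s < t := (ev_mono f).reflect_lt (by omega)
    refine ⟨i - s, ?_⟩
    rw [ev_res, show s + min (i - s) (t - s) = min i t by omega, (ev_mono f).map_min]
    omega

namespace SimplexQuotient

lemma ext_ev {n : ℕ} {f g : SimplexQuotient n} (h : ∀ i ≤ n, ev f.2.hom i = ev g.2.hom i) :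
    f = g := by
  obtain ⟨⟨⟨k⟩⟩, f⟩ := f
  obtain ⟨⟨⟨l⟩⟩, g⟩ := g
  obtain rfl : k = l := by simpa [ev_of_le] using h n le_rfl
  obtain rfl : f = g := WideSubcategory.hom_ext _ (hom_ext h)
  rfl

instance : Unique (SimplexQuotient 0) where
  default := ⟨_, 𝟙 _⟩
  uniq f := ext_ev fun i hi => by
    obtain rfl : i = 0 := by omega
    simp

/-- The restriction of a surjection to the interval from `s` to `t`, as a surjection onto its
image. -/
def res {n : ℕ} (f : SimplexQuotient n) (s t : ℕ) : SimplexQuotient (t - s) :=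
  ⟨_, ⟨FinInt.res f.2.hom s t _ _ rfl rfl, surjective_res f.2.property s t⟩⟩

lemma ev_res {n : ℕ} (f : SimplexQuotient n) {s t i : ℕ} (hi : i ≤ t - s) :
    ev (f.res s t).2.hom i = ev f.2.hom (s + i) - ev f.2.hom s := by
  simp only [res, FinInt.ev_res, min_eq_left hi]

lemma res_res_zero {n : ℕ} (f : SimplexQuotient n) {s t u : ℕ} (hst : s ≤ t) (htu : t ≤ u) :
    res (n := u) (f.res 0 u) s t = f.res s t := ext_ev fun i hi => by
  rw [ev_res _ hi, ev_res _ hi, ev_res _ (by omega), ev_res _ (by omega)]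
  simp

lemma res_zero_self {n : ℕ} (f : SimplexQuotient n) : f.res 0 n = f := ext_ev fun i hi => by
  simp [ev_res _ hi]

lemma exists_res_eq {s t : ℕ} (hst : s ≤ t) (g : SimplexQuotient s) (h : SimplexQuotient (t - s)) :
    ∃ f : SimplexQuotient t, f.res 0 s = g ∧ f.res s t = h := by
  obtain ⟨k, g⟩ := g
  obtain ⟨l, h⟩ := h
  let f : (⟨t⟩ : FinInt) ⟶ k.obj ⊗ l.obj :=
    (castIso (show t = s + (t - s) by omega)).hom ≫ (g.hom ⊗ₘ h.hom)
  have ev_f (i : ℕ) (hi : i ≤ t) :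
      ev f i = if i ≤ s then ev g.hom i else k.obj.len + ev h.hom (i - s) := by
    simp only [f, castIso, ev_comp, ev_homMk, min_eq_left hi, id_eq]
    exact ev_tensorHom _ _ _
  have ev_g : ev g.hom s = k.obj.len := ev_of_le _ le_rfl
  have ev_f_left (i : ℕ) (hi : i ≤ s) : ev f i = ev g.hom i := by
    rw [ev_f i (hi.trans hst), if_pos hi]
  have ev_f_right (i : ℕ) (hi : i ≤ t - s) : ev f (s + i) = k.obj.len + ev h.hom i := by
    rw [ev_f _ (by omega), Nat.add_sub_cancel_left]
    split_ifs with h0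
    · obtain rfl : i = 0 := by omega
      simpa using ev_g
    · rfl
  have hf : surjective f := surjective_of_exists_ev fun j hj => by
    replace hj : j ≤ k.obj.len + l.obj.len := hj
    rcases le_total j k.obj.len with hjk | hjk
    · obtain ⟨i, hi, hij⟩ := exists_ev_of_surjective g.property hjk
      exact ⟨i, by rw [ev_f_left i hi, hij]⟩
    · obtain ⟨i, hi, hij⟩ := exists_ev_of_surjective h.property
        (show j - k.obj.len ≤ l.obj.len by omega)
      exact ⟨s + i, by rw [ev_f_right i hi, hij]; omega⟩
  refine ⟨⟨⟨k.obj ⊗ l.obj⟩, ⟨f, hf⟩⟩, ext_ev fun i hi => ?_, ext_ev fun i hi => ?_⟩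
  · simpa [ev_res (s := 0) (t := s) _ hi] using ev_f_left i hi
  · rw [ev_res _ hi]
    change ev f (s + i) - ev f s = ev h.hom i
    rw [ev_f_right i hi, ev_f_left s le_rfl, ev_g, Nat.add_sub_cancel_left]

lemma bijective_res {s t : ℕ} (hst : s ≤ t) :
    Function.Bijective fun f : SimplexQuotient t =>
      ((f.res 0 s, f.res s t) : SimplexQuotient s × SimplexQuotient (t - s)) := by
  constructor
  · intro f g h
    have h₁ (i : ℕ) (hi : i ≤ s) : ev f.2.hom i = ev g.2.hom i := by
      have := congrArg (fun p => ev p.1.2.hom i) h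
      simpa [ev_res (s := 0) (t := s) _ hi] using this
    have h₂ (i : ℕ) (hi : i ≤ t - s) :
        ev f.2.hom (s + i) - ev f.2.hom s = ev g.2.hom (s + i) - ev g.2.hom s := by
      simpa only [ev_res _ hi] using congrArg (fun p => ev p.2.2.hom i) h
    refine ext_ev fun i hi => ?_
    rcases le_total i s with his | his
    · exact h₁ i his
    · have := h₂ (i - s) (by omega)
      rw [Nat.add_sub_cancel' his, h₁ s le_rfl] at this
      have := ev_mono f.2.hom his
      have := ev_mono g.2.hom his
      have := h₁ s le_rfl
      omega
  · rintro ⟨g, h⟩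
    obtain ⟨f, rfl, rfl⟩ := exists_res_eq hst g h
    exact ⟨f, rfl⟩

end SimplexQuotient

/-- The families of surjections `[t₁ - s] → [k₁]`, `[t₂ - t₁] → [k₂]`, … for the list
`[t₁, t₂, …]`. -/
@[reducible] def PathQuotient : ℕ → List ℕ → Type
  | _, [] => PUnit
  | s, t :: L => SimplexQuotient (t - s) × PathQuotient t L

namespace SimplexQuotient

/-- The restrictions of a surjection to the intervals between consecutive entries of a list. -/
def restrictions {n : ℕ} (f : SimplexQuotient n) : (s : ℕ) → (L : List ℕ) → PathQuotient s L
  | _, [] => PUnit.unit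
  | s, t :: L => (f.res s t, f.restrictions t L)

lemma bijective_restrictions {n : ℕ} (s : ℕ) (L : List ℕ) (hL : (s :: L).Pairwise (· ≤ ·))
    (hn : L.getLastD s = n) :
    Function.Bijective fun f : SimplexQuotient n =>
      ((f.res 0 s, f.restrictions s L) : SimplexQuotient s × PathQuotient s L) := by
  induction L generalizing s with
  | nil =>
    obtain rfl : s = n := hn
    refine (Equiv.prodPUnit (SimplexQuotient s)).symm.bijective.comp (?_ : Function.Bijective
      fun f : SimplexQuotient s => (f.res 0 s : SimplexQuotient s))
    convert Function.bijective_id with f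
    exact res_zero_self f
  | cons t L ih =>
    obtain ⟨hs, hL⟩ := List.pairwise_cons.1 hL
    have hst : s ≤ t := hs t (by simp)
    convert (Equiv.prodAssoc _ _ _).bijective.comp
      (((bijective_res hst).prodMap Function.bijective_id).comp
        (ih t hL (List.getLastD_cons.symm.trans hn))) with f
    · exact (res_res_zero f (Nat.zero_le s) hst).symm
    · exact Prod.ext (res_res_zero f hst le_rfl).symm rfl

end SimplexQuotient

namespace Necklace

/-- The surjective necklace maps `f : T → U` with `U = f(T)`. -/
def activeSurjective : MorphismProperty Necklace := fun T U f =>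
  surjective f.toHom ∧ U.joints = T.joints.image (ev f.toHom)

instance : activeSurjective.IsMultiplicative where
  id_mem T := ⟨surjective.id_mem _, (image_id T T.joints T.le_last).symm⟩
  comp_mem f g hf hg := ⟨surjective.comp_mem _ _ hf.1 hg.1, by
    rw [comp_toHom, image_comp, ← hf.2, hg.2]⟩

/-- The surjection underlying an active surjection of necklaces. -/
def simplexQuotient {T : Necklace} (f : Σ U, (⟨T⟩ : WideSubcategory activeSurjective) ⟶ U) :
    SimplexQuotient T.last :=
  ⟨⟨f.1.obj.vertices⟩, ⟨f.2.hom.toHom, f.2.property.1⟩⟩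

lemma bijective_simplexQuotient (T : Necklace) :
    Function.Bijective (simplexQuotient (T := T)) := by
  constructor
  · rintro ⟨⟨U⟩, f, hf⟩ ⟨⟨R⟩, g, hg⟩ h
    have ev_eq (i : ℕ) : ev f.toHom i = ev g.toHom i := congrArg (fun q => ev q.2.hom i) h
    obtain rfl : U = R := Necklace.ext (congrArg (fun q => q.1.obj.len) h) <| by
      rw [hf.2, hg.2]
      exact Finset.image_congr fun i _ => ev_eq i
    obtain rfl : f = g := hom_ext <| FinInt.hom_ext fun i _ => ev_eq i
    rfl
  · rintro ⟨⟨⟨q⟩⟩, ⟨f, hf⟩⟩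
    let U : Necklace :=
      { last := q
        joints := T.joints.image (ev f)
        zero_mem := Finset.mem_image.2 ⟨0, T.zero_mem, ev_zero f⟩
        last_mem := Finset.mem_image.2 ⟨T.last, T.last_mem, ev_of_le f le_rfl⟩
        le_last := by
          simp only [Finset.forall_mem_image]
          exact fun i _ => ev_le f i }
    exact ⟨⟨⟨U⟩, ⟨⟨f, Finset.Subset.rfl⟩, hf, rfl⟩⟩, rfl⟩

lemma getLastD_jointList (T : Necklace) : T.jointList.getLastD 0 = T.last := by
  have mem_iff (t : ℕ) : t ∈ 0 :: T.jointList ↔ t ∈ T.joints := by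
    rw [List.mem_cons, mem_jointList]
    have := T.zero_mem
    grind
  refine le_antisymm (T.le_last _ ((mem_iff _).1 List.getLastD_mem_cons)) ?_
  rw [← List.getLast_eq_getLastD (List.cons_ne_nil _ _)]
  exact T.pairwise_jointList.rel_getLast ((mem_iff _).2 T.last_mem)

lemma bijective_restrictions (T : Necklace) :
    Function.Bijective fun f : Σ U, (⟨T⟩ : WideSubcategory activeSurjective) ⟶ U =>
      (simplexQuotient f).restrictions 0 T.jointList := by
  have := SimplexQuotient.bijective_restrictions 0 T.jointList T.pairwise_jointList
    T.getLastD_jointList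
  exact (Equiv.uniqueProd _ (SimplexQuotient 0)).bijective.comp
    (this.comp T.bijective_simplexQuotient)

end Necklace

section Paths

variable {W : Type*} [Category* W] [MonoidalCategory W]

/-- The tensor product of the morphisms `g n : A n ⟶ B n` along a list of joints. -/
def pathMap {A B : ℕ → W} (g : ∀ n, A n ⟶ B n) :
    (s : ℕ) → (L : List ℕ) → (pathTensor A s L ⟶ pathTensor B s L)
  | _, [] => 𝟙 _
  | s, t :: L => g (t - s) ⊗ₘ pathMap g t L

namespace PathQuotient

/-- The tensor product of the objects `A k` at the targets of a family of surjections. -/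
@[reducible] def obj (A : ℕ → W) : (s : ℕ) → (L : List ℕ) → PathQuotient s L → W
  | _, [], _ => 𝟙_ W
  | _, t :: L, σ => A σ.1.1.obj.len ⊗ obj A t L σ.2

variable (X : FinIntᵒᵖ ⥤ W) {A : ℕ → W} (g : ∀ n, A n ⟶ simplices X n)

/-- The tensor product of the morphisms `A k → X k → X (t - s)` induced by a family of
surjections. -/
def map : (s : ℕ) → (L : List ℕ) → (σ : PathQuotient s L) →
    (obj A s L σ ⟶ pathTensor (simplices X) s L)
  | _, [], _ => 𝟙 _
  | _, t :: L, σ => (g σ.1.1.obj.len ≫ X.map σ.1.2.hom.op) ⊗ₘ map t L σ.2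

lemma exists_iso_map_restrictions {n : ℕ} (f : SimplexQuotient n) {r s : ℕ} {L' L : List ℕ}
    (h : ev f.2.hom s = r) (hL : L.map (ev f.2.hom) = L') :
    ∃ e : pathTensor A r L' ≅ obj A s L (f.restrictions s L),
      e.hom ≫ map X g s L (f.restrictions s L) =
        pathMap g r L' ≫ active (X := X) f.2.hom r s h L' L hL := by
  induction L generalizing r s L' with
  | nil =>
    subst hL
    exact ⟨Iso.refl _, rfl⟩
  | cons t L ih =>
    subst h hL
    obtain ⟨e, he⟩ := ih (s := t) rfl rfl
    refine ⟨whiskerLeftIso _ e, ?_⟩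
    change (_ ◁ e.hom) ≫ ((g _ ≫ X.map (FinInt.res f.2.hom s t _ _ rfl rfl).op) ⊗ₘ map X g t L _) =
      (g _ ⊗ₘ pathMap g _ _) ≫
        (X.map (FinInt.res f.2.hom s t _ _ rfl rfl).op ⊗ₘ active f.2.hom _ t rfl _ L rfl)
    rw [tensorHom_comp_tensorHom, ← he, ← id_tensorHom, tensorHom_comp_tensorHom, Category.id_comp]

end PathQuotient

lemma exists_eq_cons_of_sublist {t : ℕ} {M L : List ℕ} (hM : M.Pairwise (· < ·))
    (hL : (t :: L).Pairwise (· ≤ ·)) (h : M.Sublist (t :: L)) (ht : t ∈ M) :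
    ∃ M', M = t :: M' := by
  obtain _ | ⟨m, M⟩ := M
  · simp at ht
  have htm : t ≤ m := by
    rcases List.mem_cons.1 (h.subset List.mem_cons_self) with rfl | hm
    · exact le_rfl
    · exact (List.pairwise_cons.1 hL).1 m hm
  rcases List.mem_cons.1 ht with rfl | ht
  · exact ⟨M, rfl⟩
  · exact absurd ((List.pairwise_cons.1 hM).1 t ht) htm.not_gt

section Unital

variable (X : FinIntᵒᵖ ⥤ W) [X.OplaxMonoidal] [IsIso (Functor.OplaxMonoidal.η X)]

lemma refine_cons_self {s : ℕ} {M L : List ℕ} (hL : (s :: s :: L).Pairwise (· ≤ ·))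
    (h : M.Sublist L) (h' : M.Sublist (s :: L)) :
    refine X s M (s :: L) h' = refine X s M L h ≫ ins X s L := by
  rw [ins_nat, ← refine_keep X s s (h.cons_cons s) h, ins_refine X s _ hL]

variable {X} {A : ℕ → W} (g : ∀ n, A n ⟶ simplices X n) [IsIso (g 0)]

lemma exists_iso_pathMap_ins (s : ℕ) (M : List ℕ) :
    ∃ e : pathTensor A s M ≅ pathTensor A s (s :: M),
      e.hom ≫ pathMap g s (s :: M) = pathMap g s M ≫ ins X s M := by
  have : IsIso (g (s - s)) := by rwa [Nat.sub_self]
  let w : 𝟙_ W ≅ A (s - s) := asIso (unitMap X (s - s)) ≪≫ (asIso (g (s - s))).symm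
  have hw : w.hom ≫ g (s - s) = unitMap X (s - s) := by simp [w]
  refine ⟨(λ_ _).symm ≪≫ whiskerRightIso w _, ?_⟩
  change ((λ_ _).inv ≫ w.hom ▷ _) ≫ (g (s - s) ⊗ₘ pathMap g s M) = _
  rw [ins, leftUnitor_inv_naturality_assoc, ← hw, MonoidalCategory.tensorHom_def', Category.assoc,
    ← whisker_exchange_assoc, comp_whiskerRight]

/-- Only trivial beads are inserted, on which `g 0` is invertible. -/
lemma exists_iso_pathMap_refine {r : ℕ} {M L : List ℕ} (hM : (r :: M).Pairwise (· < ·))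
    (hL : (r :: L).Pairwise (· ≤ ·)) (hML : M.Sublist L) (hLM : L ⊆ r :: M) :
    ∃ e : pathTensor A r M ≅ pathTensor A r L,
      e.hom ≫ pathMap g r L = pathMap g r M ≫ refine X r M L hML := by
  induction L generalizing r M with
  | nil =>
    obtain rfl : M = [] := by simpa using hML
    exact ⟨Iso.refl _, by simp [pathMap, refine]⟩
  | cons t L ih =>
    obtain ⟨hrL, hL'⟩ := List.pairwise_cons.1 hL
    obtain ⟨hrM, hM'⟩ := List.pairwise_cons.1 hM
    by_cases htr : t = r
    · subst htr
      have hML' : M.Sublist L := (List.sublist_cons_iff.1 hML).resolve_right <| by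
        rintro ⟨M', rfl, -⟩
        exact lt_irrefl _ (hrM t (by simp))
      obtain ⟨e, he⟩ := ih hM hL' hML' (List.cons_subset.1 hLM).2
      obtain ⟨e', he'⟩ := exists_iso_pathMap_ins g t L
      exact ⟨e ≪≫ e', by
        rw [Iso.trans_hom, Category.assoc, he', reassoc_of% he, refine_cons_self X hL hML']⟩
    · obtain ⟨M, rfl⟩ : ∃ M', M = t :: M' :=
        exists_eq_cons_of_sublist hM' hL' hML ((List.mem_cons.1 (hLM (by simp))).resolve_left htr)
      have hML' : M.Sublist L := List.cons_sublist_cons.1 hML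
      obtain ⟨e, he⟩ := ih hM' hL' hML' fun x hx =>
        (List.mem_cons.1 (hLM (List.mem_cons_of_mem t hx))).resolve_left
          ((hrM t (by simp)).trans_le ((List.pairwise_cons.1 hL').1 x hx)).ne'
      refine ⟨whiskerLeftIso _ e, ?_⟩
      simp only [whiskerLeftIso_hom, pathMap, refine_keep X r t hML hML', ← id_tensorHom,
        tensorHom_comp_tensorHom, he, Category.id_comp, Category.comp_id]

end Unital

end Paths

lemma IsFreeOn.isIso_of_len_zero {W : Type*} [Category* W] {Y : SimplexSurjᵒᵖ ⥤ W}
    {nd : SimplexSurj → W} {incl : ∀ n, nd n ⟶ Y.obj (op n)} (h : IsFreeOn Y incl) :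
    IsIso (incl ⟨⟨0⟩⟩) := by
  have : IsIso (incl ⟨⟨0⟩⟩ ≫ Y.map (𝟙 _)) := (h ⟨⟨0⟩⟩).isIso_of_unique (I := SimplexQuotient 0)
  simpa using this

namespace VQuiv

variable {V : Type u} [Category.{v} V] [MonoidalCategory V] [SymmetricCategory V]
  [MonoidalClosed V] [HasColimits V] {S : Type v}

lemma isCoproduct_pathQuotient_map {X : FinIntᵒᵖ ⥤ VQuiv V S} {A : ℕ → VQuiv V S}
    {g : ∀ n, A n ⟶ simplices X n}
    (h : ∀ n, IsCoproduct fun f : SimplexQuotient n => g f.1.obj.len ≫ X.map f.2.hom.op)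
    (s : ℕ) (L : List ℕ) : IsCoproduct (PathQuotient.map X g s L) := by
  have : HasColimitsOfSize.{0, 0} V := hasColimitsOfSizeShrink.{0, 0, v, v} V
  induction L generalizing s with
  | nil =>
    have : IsIso (PathQuotient.map X g s [] default) := inferInstanceAs (IsIso (𝟙 _))
    exact .of_unique
  | cons t L ih => exact isCoproduct_tensor (h (t - s)) (ih t)

end VQuiv

lemma Necklace.pairwise_lt_jointList (T : Necklace) : (0 :: T.jointList).Pairwise (· < ·) :=
  List.pairwise_cons.2 ⟨fun _ ht => Nat.pos_of_ne_zero (mem_jointList.1 ht).1,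
    Finset.sortedLT_sort _ |>.pairwise⟩

namespace TemplicialObject.NonDegenerate

variable {V : Type u} [Category.{v} V] [MonoidalCategory V] [SymmetricCategory V]
  [MonoidalClosed V] [HasColimits V] {S : Type v} {X : TemplicialObject V S} (N : X.NonDegenerate)

lemma isFreeOn_restrict : IsFreeOn X.restrict fun k => N.incl k.obj.len :=
  isFreeOn_of_isColimit_degenerateMap fun k => N.isColimit k.obj.len

instance : IsIso (N.incl 0) := N.isFreeOn_restrict.isIso_of_len_zero

/-- The canonical morphism `X_T^nd → X_T`. -/
def inclNecklace (T : Necklace) :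
    N.ndNecklace T ⟶ (Necklace.necklaceFunctor X.functor).obj (op T) :=
  pathMap N.incl 0 T.jointList

lemma exists_iso_inclNecklace_map {T : Necklace}
    (f : Σ U, (⟨T⟩ : WideSubcategory Necklace.activeSurjective) ⟶ U) :
    ∃ e : N.ndNecklace f.1.obj ≅
        PathQuotient.obj N.nd 0 T.jointList
          ((Necklace.simplexQuotient f).restrictions 0 T.jointList),
      e.hom ≫ PathQuotient.map X.functor N.incl 0 T.jointList
          ((Necklace.simplexQuotient f).restrictions 0 T.jointList) =
        N.inclNecklace f.1.obj ≫ (Necklace.necklaceFunctor X.functor).map f.2.hom.op := by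
  obtain ⟨⟨U⟩, f, hf⟩ := f
  obtain ⟨e, he⟩ := exists_iso_pathMap_refine N.incl U.pairwise_lt_jointList
    (Necklace.pairwise_map f.toHom T.pairwise_jointList) (Necklace.sublist_map f) <| by
      intro i hi
      obtain ⟨j, hj, rfl⟩ := List.mem_map.1 hi
      rw [List.mem_cons, Necklace.mem_jointList, hf.2]
      exact (eq_or_ne _ 0).imp_right fun h =>
        ⟨h, Finset.mem_image_of_mem _ (Necklace.mem_jointList.1 hj).2⟩
  obtain ⟨e', he'⟩ := PathQuotient.exists_iso_map_restrictions X.functor N.incl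
    (Necklace.simplexQuotient ⟨⟨U⟩, ⟨f, hf⟩⟩) (ev_zero _) (Eq.refl (T.jointList.map _))
  exact ⟨e ≪≫ e', (Category.assoc _ _ _).trans <| (e.hom ≫= he').trans <|
    (Category.assoc _ _ _).symm.trans <| (he =≫ _).trans (Category.assoc _ _ _)⟩

lemma isFreeOn_necklaceFunctor :
    IsFreeOn ((wideSubcategoryInclusion Necklace.activeSurjective).op ⋙
      Necklace.necklaceFunctor X.functor) fun T => N.inclNecklace T.obj := by
  rintro ⟨T⟩
  choose e he using N.exists_iso_inclNecklace_map (T := T)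
  exact ((VQuiv.isCoproduct_pathQuotient_map
    (fun n => N.isFreeOn_restrict ⟨⟨n⟩⟩) 0 T.jointList).reindex
      T.bijective_restrictions).of_iso e he

end TemplicialObject.NonDegenerate

open Simplicial

/-! ### Flanked flags -/

namespace FinInt

variable {l m n : FinInt}

lemma surjective_iff_image_range {f : m ⟶ n} :
    surjective f ↔ (Finset.range (m.len + 1)).image (ev f) = Finset.range (n.len + 1) := by
  refine ⟨fun hf => ?_, fun hf => surjective_of_exists_ev fun j hj => ?_⟩
  · ext j
    simp only [Finset.mem_image, Finset.mem_range, Nat.lt_succ_iff]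
    exact ⟨fun ⟨i, _, hi⟩ => hi ▸ ev_le f i, exists_ev_of_surjective hf⟩
  · obtain ⟨i, -, hi⟩ := Finset.mem_image.1 (hf ▸ Finset.mem_range.2 (Nat.lt_succ_of_le hj))
    exact ⟨i, hi⟩

lemma exists_injOn_image_range_eq {B : Finset ℕ} (h_zero : 0 ∈ B) (h_last : n.len ∈ B)
    (h_le : ∀ t ∈ B, t ≤ n.len) :
    ∃ (m : FinInt) (κ : m ⟶ n), Set.InjOn (ev κ) (Finset.range (m.len + 1)) ∧
      (Finset.range (m.len + 1)).image (ev κ) = B := by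
  obtain ⟨p, hp⟩ := Nat.exists_eq_succ_of_ne_zero (Finset.card_ne_zero_of_mem h_zero)
  let e := B.orderEmbOfFin hp
  have he (i) : e i ∈ B := B.orderEmbOfFin_mem hp i
  have he_surj {t : ℕ} (ht : t ∈ B) : ∃ i, e i = t :=
    (B.range_orderEmbOfFin hp).ge ht
  let κ : (⟨p⟩ : FinInt) ⟶ n :=
    { toOrderHom := ⟨fun i => ⟨e i, Nat.lt_succ_of_le (h_le _ (he i))⟩, fun i j h => e.monotone h⟩
      map_zero := by
        obtain ⟨i, hi⟩ := he_surj h_zero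
        exact Fin.ext (Nat.le_zero.1 ((e.monotone (Fin.zero_le i)).trans_eq hi))
      map_last := by
        obtain ⟨i, hi⟩ := he_surj h_last
        exact Fin.ext (le_antisymm (h_le _ (he _))
          (hi.symm.trans_le (e.monotone (Fin.le_last i)))) }
  have hκ (i : Fin (p + 1)) : ev κ i = e i := ev_fin κ i
  refine ⟨⟨p⟩, κ, fun i hi j hj hij => ?_, ?_⟩
  · lift i to Fin (p + 1) using by simpa using hi
    lift j to Fin (p + 1) using by simpa using hj
    rw [hκ, hκ] at hij
    rw [e.injective hij]
  · ext t
    simp only [Finset.mem_image, Finset.mem_range]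
    constructor
    · rintro ⟨i, hi, rfl⟩
      exact hκ ⟨i, hi⟩ ▸ he _
    · intro ht
      obtain ⟨i, rfl⟩ := he_surj ht
      exact ⟨i, i.2, hκ i⟩

lemma exists_comp_eq_of_image_range_subset {κ : m ⟶ n}
    (hκ : Set.InjOn (ev κ) (Finset.range (m.len + 1))) {f : l ⟶ n}
    (hf : (Finset.range (l.len + 1)).image (ev f) ⊆ (Finset.range (m.len + 1)).image (ev κ)) :
    ∃ h : l ⟶ m, h ≫ κ = f := by
  have h_ex (i : Fin (l.len + 1)) : ∃ j : Fin (m.len + 1), κ.toOrderHom j = f.toOrderHom i := by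
    obtain ⟨j, hj, hji⟩ := Finset.mem_image.1
      (hf (Finset.mem_image_of_mem _ (Finset.mem_range.2 i.2)))
    exact ⟨⟨j, Finset.mem_range.1 hj⟩, Fin.ext (by rw [← ev_fin, ← ev_fin, hji])⟩
  choose h hh using h_ex
  have hκ_inj : Function.Injective κ.toOrderHom := fun i j hij => Fin.ext <|
    hκ (Finset.mem_coe.2 (Finset.mem_range.2 i.2)) (Finset.mem_coe.2 (Finset.mem_range.2 j.2))
      (by rw [ev_fin, ev_fin, hij])
  have hκ_mono : StrictMono κ.toOrderHom := κ.toOrderHom.monotone.strictMono_of_injective hκ_inj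
  refine ⟨⟨⟨h, fun i j hij => ?_⟩, hκ_inj ?_, hκ_inj ?_⟩, ?_⟩
  · rw [← hκ_mono.le_iff_le, hh, hh]
    exact f.toOrderHom.monotone hij
  · exact (hh 0).trans (f.map_zero.trans κ.map_zero.symm)
  · exact (hh _).trans (f.map_last.trans κ.map_last.symm)
  · exact Hom.ext (OrderHom.ext _ _ (funext hh))

end FinInt

namespace Necklace

/-- The functor sending a necklace to the set of its flags of length `n`. -/
def flagFunctor (n : ℕ) : Necklace ⥤ Type := flags ⋙ (evaluation _ _).obj (op ⦋n⦌)

/-- A flag of length `n` on `T`. -/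
abbrev Flag (n : ℕ) (T : Necklace) : Type := (flagFunctor n).obj T

lemma mono_of_injOn {R T : Necklace} {κ : R ⟶ T}
    (hκ : Set.InjOn (ev κ.toHom) (Finset.range (R.last + 1))) : Mono κ where
  right_cancellation g h hgh := hom_ext <| FinInt.hom_ext fun i _ => by
    have h_ev : ev (g ≫ κ).toHom i = ev (h ≫ κ).toHom i := by rw [hgh]
    rw [comp_toHom, comp_toHom, ev_comp, ev_comp] at h_ev
    exact hκ (Finset.mem_range.2 (Nat.lt_succ_of_le (ev_le _ _)))
      (Finset.mem_range.2 (Nat.lt_succ_of_le (ev_le _ _))) h_ev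

namespace Flag

variable {n : ℕ} {T U R R' : Necklace}

/-- The sets `T₀ ⊆ … ⊆ Tₙ` of a flag. -/
def sets (x : Flag n T) (i : Fin (n + 1)) : Finset ℕ :=
  ((show ComposableArrows T.Poset n from x).obj i).1

lemma sets_map (f : T ⟶ U) (x : Flag n T) (i : Fin (n + 1)) :
    sets ((flagFunctor n).map f x) i = (x.sets i).image (ev f.toHom) := rfl

lemma ext {x y : Flag n T} (h : ∀ i, x.sets i = y.sets i) : x = y :=
  CategoryTheory.Functor.ext (fun i => Subtype.ext (h i)) fun _ _ _ => Subsingleton.elim _ _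

lemma monotone_sets (x : Flag n T) : Monotone x.sets := fun _ _ h =>
  leOfHom ((show ComposableArrows T.Poset n from x).map (homOfLE h))

lemma joints_subset (x : Flag n T) (i : Fin (n + 1)) : T.joints ⊆ x.sets i :=
  ((show ComposableArrows T.Poset n from x).obj i).2.1

lemma le_last (x : Flag n T) {i : Fin (n + 1)} {t : ℕ} (ht : t ∈ x.sets i) : t ≤ T.last :=
  ((show ComposableArrows T.Poset n from x).obj i).2.2 t ht

/-- The flag consisting of an increasing sequence of sets. -/
def ofMonotone (A : Fin (n + 1) → Finset ℕ) (hA : Monotone A) (h_joints : T.joints ⊆ A 0)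
    (h_last : ∀ t ∈ A (Fin.last n), t ≤ T.last) : Flag n T :=
  Monotone.functor (f := fun i => (⟨A i, h_joints.trans (hA (Fin.zero_le i)), fun t ht =>
    h_last t (hA (Fin.le_last i) ht)⟩ : T.Poset)) fun _ _ h => hA h

/-- A flag is flanked if it starts with the joints and ends with all vertices. -/
def IsFlanked (x : Flag n T) : Prop :=
  x.sets 0 = T.joints ∧ x.sets (Fin.last n) = Finset.range (T.last + 1)

lemma IsFlanked.map_iff {x : Flag n T} (hx : x.IsFlanked) {f : T ⟶ U} :
    IsFlanked ((flagFunctor n).map f x) ↔ activeSurjective f := by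
  rw [IsFlanked, sets_map, sets_map, hx.1, hx.2, activeSurjective,
    FinInt.surjective_iff_image_range, and_comm, eq_comm (a := Finset.image _ T.joints)]

lemma exists_isFlanked_map_eq (x : Flag n T) :
    ∃ (R : Necklace) (κ : R ⟶ T) (y : Flag n R),
      Set.InjOn (ev κ.toHom) (Finset.range (R.last + 1)) ∧ y.IsFlanked ∧
        (flagFunctor n).map κ y = x := by
  obtain ⟨⟨p⟩, κ, hκ_inj, hκ⟩ := FinInt.exists_injOn_image_range_eq (n := T.vertices)
    (x.joints_subset (Fin.last n) T.zero_mem) (x.joints_subset _ T.last_mem) fun _ => x.le_last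
  let A (i : Fin (n + 1)) : Finset ℕ := (Finset.range (p + 1)).filter fun t => ev κ t ∈ x.sets i
  have hA_mono : Monotone A := fun i j h =>
    Finset.monotone_filter_right _ fun t _ ht => x.monotone_sets h ht
  have hA (i) : (A i).image (ev κ) = x.sets i := by
    have : x.sets i ⊆ (Finset.range (p + 1)).image (ev κ) :=
      hκ ▸ x.monotone_sets (Fin.le_last i)
    exact Finset.filter_image.symm.trans
      (Finset.filter_mem_eq_inter.trans (Finset.inter_eq_right.2 this))
  have hA_le (i) : ∀ t ∈ A i, t ≤ p := fun t ht => by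
    simpa [Nat.lt_succ_iff] using (Finset.mem_filter.1 ht).1
  let R : Necklace :=
    { last := p
      joints := A 0
      zero_mem := by simpa [A] using x.joints_subset 0 T.zero_mem
      last_mem := by
        simpa [A, ev_of_le κ (le_refl p)] using x.joints_subset 0 T.last_mem
      le_last := hA_le 0 }
  refine ⟨R, ⟨κ, (hA 0).symm ▸ x.joints_subset 0⟩, .ofMonotone A hA_mono subset_rfl (hA_le _),
    hκ_inj, ⟨rfl, Finset.filter_true_of_mem fun t ht => ?_⟩, ext hA⟩
  exact hκ ▸ Finset.mem_image_of_mem _ ht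

lemma IsFlanked.exists_lift {κ : R ⟶ T} (hκ : Set.InjOn (ev κ.toHom) (Finset.range (R.last + 1)))
    {y : Flag n R} (hy : y.IsFlanked) {y' : Flag n R'} (hy' : y'.IsFlanked) {f : R' ⟶ T}
    (hf : (flagFunctor n).map f y' = (flagFunctor n).map κ y) :
    ∃ h : R' ⟶ R, h ≫ κ = f ∧ (flagFunctor n).map h y' = y := by
  have h_sets (i) : (y'.sets i).image (ev f.toHom) = (y.sets i).image (ev κ.toHom) :=
    congrArg (fun x : Flag n T => x.sets i) hf
  obtain ⟨h, hh⟩ := FinInt.exists_comp_eq_of_image_range_subset hκ (f := f.toHom) <| by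
    rw [← hy.2, ← h_sets, hy'.2]
  have h_image (i) : (y'.sets i).image (ev h) = y.sets i := by
    refine (Finset.image_eq_image_iff_of_injOn hκ (fun t ht => ?_) fun t ht => ?_).1 ?_
    · obtain ⟨s, -, rfl⟩ := Finset.mem_image.1 ht
      exact Finset.mem_range.2 (Nat.lt_succ_of_le (ev_le h s))
    · exact Finset.mem_range.2 (Nat.lt_succ_of_le (y.le_last ht))
    · rw [← h_sets, ← hh, image_comp]
  refine ⟨⟨h, ?_⟩, hom_ext hh, ext h_image⟩
  rw [← hy'.1, h_image, hy.1]

end Flag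

end Necklace

open Necklace

lemma initial_of_isTerminal_costructuredArrow {C D : Type*} [Category* C] [Category* D]
    {F : C ⥤ D} (h : ∀ d, ∃ f : CostructuredArrow F d, Nonempty (IsTerminal f)) : F.Initial where
  out d := isConnected_of_isTerminal _ (h d).choose_spec.some

namespace FlankedFlag

variable {n : ℕ}

/-- A flanked flag as an object of the category of flags of length `n` on varying necklaces. -/
def toElements (F : FlankedFlag n) : (flagFunctor n).Elements := ⟨F.necklace, F.flag⟩

lemma isFlanked (F : FlankedFlag n) : Flag.IsFlanked F.toElements.2 := ⟨F.first, F.last⟩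

instance : Category (FlankedFlag n) :=
  inferInstanceAs (Category (InducedCategory _ (toElements (n := n))))

/-- The inclusion of the flanked flags in the category of flags. -/
def inclusion (n : ℕ) : FlankedFlag n ⥤ (flagFunctor n).Elements := inducedFunctor toElements

lemma exists_isTerminal_costructuredArrow (x : (flagFunctor n).Elements) :
    ∃ f : CostructuredArrow (inclusion n) x, Nonempty (IsTerminal f) := by
  obtain ⟨R, κ, y, hκ, hy, hx⟩ := Flag.exists_isFlanked_map_eq x.2
  have := mono_of_injOn hκ
  let F : FlankedFlag n := ⟨R, y, hy.1, hy.2⟩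
  let ε : CostructuredArrow (inclusion n) x := .mk (Y := F) (CategoryOfElements.homMk _ _ κ hx)
  have h_lift (g : CostructuredArrow (inclusion n) x) :
      ∃ h : g.left.necklace ⟶ R, h ≫ κ = g.hom.1 ∧ (flagFunctor n).map h g.left.flag = y :=
    hy.exists_lift hκ g.left.isFlanked (g.hom.2.trans hx.symm)
  choose h hhκ hhy using h_lift
  refine ⟨ε, ⟨IsTerminal.ofUniqueHom
    (fun g => CostructuredArrow.homMk ⟨h g, hhy g⟩ (Subtype.ext (hhκ g))) fun g m => ?_⟩⟩
  have hm : m.left.hom.1 ≫ κ = h g ≫ κ :=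
    (congrArg Subtype.val (CostructuredArrow.w m)).trans (hhκ g).symm
  exact CostructuredArrow.hom_ext _ _
    (InducedCategory.hom_ext (Subtype.ext ((cancel_mono κ).1 hm)))

instance : (inclusion n).Initial :=
  initial_of_isTerminal_costructuredArrow exists_isTerminal_costructuredArrow

/-- The functor sending a flanked flag to its necklace. Morphisms of flanked flags are active
surjections. -/
def toNecklace (n : ℕ) : FlankedFlag n ⥤ WideSubcategory activeSurjective where
  obj F := ⟨F.necklace⟩
  map {F G} f := ⟨f.hom.1, F.isFlanked.map_iff.1 (f.hom.2.symm ▸ G.isFlanked)⟩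

lemma isDiscreteOpfibration_toNecklace : IsDiscreteOpfibration (toNecklace n) := by
  intro F
  constructor
  · rintro ⟨⟨U, y, _, _⟩, ⟨⟨(f : F.necklace ⟶ U), hf : (flagFunctor n).map f F.flag = y⟩⟩⟩
      ⟨⟨R, z, _, _⟩, ⟨⟨(g : F.necklace ⟶ R), hg : (flagFunctor n).map g F.flag = z⟩⟩⟩ h
    subst hf hg
    obtain rfl : U = R := congrArg (fun k => k.1.obj) h
    obtain rfl : f = g := congrArg InducedWideCategory.Hom.hom (eq_of_heq (Sigma.mk.inj_iff.1 h).2)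
    rfl
  · rintro ⟨⟨U⟩, f, hf⟩
    have hG := F.isFlanked.map_iff.2 hf
    exact ⟨⟨⟨U, _, hG.1, hG.2⟩, ⟨CategoryOfElements.homMk _ _ f rfl⟩⟩, rfl⟩

end FlankedFlag

/-! ### Simplices of weighted colimits -/

namespace weightedColimit

variable {V : Type u} [Category.{v} V] [MonoidalCategory V] [HasColimits V]

section Presentation

variable (Y : Necklaceᵒᵖ ⥤ V) (G : Necklace ⥤ SimplicialObject V)

/-- The summand `Y_T · G_T` of the target of the coequaliser defining `weightedColimit Y G`. -/
abbrev term (T : Necklace) : SimplicialObject V := ((tensoring V).obj (Y.obj (op T))).obj (G.obj T)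

/-- The summand `Y_U · G_T` of the source of the coequaliser defining `weightedColimit Y G`. -/
abbrev relation (f : Σ T U : Necklace, T ⟶ U) : SimplicialObject V :=
  ((tensoring V).obj (Y.obj (op f.2.1))).obj (G.obj f.1)

/-- The morphism given by the action of necklace maps on `Y`. -/
abbrev fst : ∐ relation Y G ⟶ ∐ term Y G :=
  Sigma.desc fun f => ((tensoring V).map (Y.map f.2.2.op)).app (G.obj f.1) ≫ Sigma.ι (term Y G) f.1

/-- The morphism given by the action of necklace maps on `G`. -/
abbrev snd : ∐ relation Y G ⟶ ∐ term Y G :=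
  Sigma.desc fun f =>
    ((tensoring V).obj (Y.obj (op f.2.1))).map (G.map f.2.2) ≫ Sigma.ι (term Y G) f.2.1

/-- The canonical morphism `Y_T · G_T ⟶ weightedColimit Y G`. -/
def ι (T : Necklace) : term Y G T ⟶ weightedColimit Y G :=
  Sigma.ι (term Y G) T ≫ coequalizer.π (fst Y G) (snd Y G)

lemma map_ι {T U : Necklace} (f : T ⟶ U) :
    ((tensoring V).map (Y.map f.op)).app (G.obj T) ≫ ι Y G T =
      ((tensoring V).obj (Y.obj (op U))).map (G.map f) ≫ ι Y G U := by
  have h := Sigma.ι (relation Y G) ⟨T, U, f⟩ ≫= coequalizer.condition (fst Y G) (snd Y G)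
  simp only [Sigma.ι_desc_assoc, Category.assoc] at h
  exact h

variable {Y G} {m : SimplexCategoryᵒᵖ} {Z : V}

lemma obj_hom_ext {g h : (weightedColimit Y G).obj m ⟶ Z}
    (hgh : ∀ T, (ι Y G T).app m ≫ g = (ι Y G T).app m ≫ h) : g = h := by
  have h_term : IsCoproduct fun T => (Sigma.ι (term Y G) T).app m :=
    IsCoproduct.map ((evaluation _ V).obj m) ⟨coproductIsCoproduct _⟩
  refine Cofork.IsColimit.hom_ext (isColimitOfHasCoequalizerOfPreservesColimit
    ((evaluation _ V).obj m) (fst Y G) (snd Y G)) (h_term.hom_ext fun T => ?_)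
  exact (Category.assoc _ _ _).symm.trans ((hgh T).trans (Category.assoc _ _ _))

lemma exists_obj_desc (φ : ∀ T : Necklace, (term Y G T).obj m ⟶ Z)
    (hφ : ∀ {T U : Necklace} (f : T ⟶ U),
      (((tensoring V).map (Y.map f.op)).app (G.obj T)).app m ≫ φ T =
        (((tensoring V).obj (Y.obj (op U))).map (G.map f)).app m ≫ φ U) :
    ∃ d : (weightedColimit Y G).obj m ⟶ Z, ∀ T, (ι Y G T).app m ≫ d = φ T := by
  have h_term : IsCoproduct fun T => (Sigma.ι (term Y G) T).app m :=
    IsCoproduct.map ((evaluation _ V).obj m) ⟨coproductIsCoproduct _⟩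
  have h_relation : IsCoproduct fun f => (Sigma.ι (relation Y G) f).app m :=
    IsCoproduct.map ((evaluation _ V).obj m) ⟨coproductIsCoproduct _⟩
  obtain ⟨k, hk⟩ := h_term.exists_desc φ
  obtain ⟨d, hd⟩ := Cofork.IsColimit.desc' (isColimitOfHasCoequalizerOfPreservesColimit
    ((evaluation _ V).obj m) (fst Y G) (snd Y G)) k <| h_relation.hom_ext fun f => by
      change (Sigma.ι (relation Y G) f).app m ≫ (fst Y G).app m ≫ k =
        (Sigma.ι (relation Y G) f).app m ≫ (snd Y G).app m ≫ k
      rw [← Category.assoc, ← Category.assoc, ← NatTrans.comp_app, ← NatTrans.comp_app,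
        Sigma.ι_desc, Sigma.ι_desc, NatTrans.comp_app, NatTrans.comp_app, Category.assoc,
        Category.assoc, hk, hk, hφ]
  exact ⟨d, fun T => (Category.assoc _ _ _).trans ((_ ≫= hd).trans (hk T))⟩

end Presentation

section Free

/-- The coprojection `I ⟶ F E` at `x : E`. -/
def freeι {E : Type} (x : E) : 𝟙_ V ⟶ (free V).obj E := Sigma.ι (fun _ : E => 𝟙_ V) x

lemma freeι_map {E E' : Type} (g : E ⟶ E') (x : E) :
    freeι (V := V) x ≫ (free V).map g = freeι (g x) := by
  simp [freeι, free]

/-- The coprojection `A ⟶ A ⊗ F E` at `x : E`. -/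
def tensorFreeι (A : V) {E : Type} (x : E) : A ⟶ A ⊗ (free V).obj E := (ρ_ A).inv ≫ A ◁ freeι x

lemma tensorFreeι_whiskerRight {A B : V} (f : A ⟶ B) {E : Type} (x : E) :
    tensorFreeι A x ≫ f ▷ (free V).obj E = f ≫ tensorFreeι B x := by
  simp [tensorFreeι, whisker_exchange]

lemma tensorFreeι_whiskerLeft_map (A : V) {E E' : Type} (g : E ⟶ E') (x : E) :
    tensorFreeι A x ≫ A ◁ (free V).map g = tensorFreeι A (g x) := by
  simp [tensorFreeι, ← MonoidalCategory.whiskerLeft_comp, freeι_map]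

lemma isCoproduct_tensorFreeι [MonoidalClosed V] (A : V) (E : Type) :
    IsCoproduct fun x : E => tensorFreeι A x :=
  have : HasColimitsOfSize.{0, 0} V := inferInstance
  have h : IsCoproduct fun x : E => freeι (V := V) x := ⟨coproductIsCoproduct _⟩
  (h.whiskerLeft A).of_iso (fun _ => (ρ_ A).symm) fun _ => rfl

variable (Y : Necklaceᵒᵖ ⥤ V) (P : Necklace ⥤ SSet.{0}) {m : SimplexCategoryᵒᵖ}

/-- The simplicial objects `F P_T`. -/
abbrev freeSimplicial : Necklace ⥤ SimplicialObject V :=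
  P ⋙ (SimplicialObject.whiskering (Type) V).obj (free V)

/-- The canonical morphism `Y_T ⊗ F (P_T)_m ⟶ (weightedColimit Y (F P))_m`. -/
def objι (T : Necklace) : Y.obj (op T) ⊗ (free V).obj ((P.obj T).obj m) ⟶
    (weightedColimit Y (freeSimplicial P)).obj m :=
  (ι Y (freeSimplicial P) T).app m

lemma map_objι {T U : Necklace} (f : T ⟶ U) :
    Y.map f.op ▷ (free V).obj ((P.obj T).obj m) ≫ objι Y P T =
      Y.obj (op U) ◁ (free V).map ((P.map f).app m) ≫ objι Y P U :=
  NatTrans.congr_app (map_ι Y (freeSimplicial P) f) m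

/-- The morphism `Y_T ⟶ (weightedColimit Y (F P))_m` at an `m`-simplex of `P_T`. -/
def elementι {T : Necklace} (x : (P.obj T).obj m) :
    Y.obj (op T) ⟶ (weightedColimit Y (freeSimplicial P)).obj m :=
  tensorFreeι (Y.obj (op T)) x ≫ objι Y P T

lemma map_elementι {T U : Necklace} (f : T ⟶ U) (x : (P.obj T).obj m) :
    Y.map f.op ≫ elementι Y P x = elementι Y P ((P.map f).app m x) := by
  rw [elementι, ← Category.assoc, ← tensorFreeι_whiskerRight, Category.assoc, map_objι,
    ← Category.assoc, tensorFreeι_whiskerLeft_map, elementι]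

variable {Y P} [MonoidalClosed V] {Z : V}

lemma element_hom_ext {g h : (weightedColimit Y (freeSimplicial P)).obj m ⟶ Z}
    (hgh : ∀ (T : Necklace) (x : (P.obj T).obj m), elementι Y P x ≫ g = elementι Y P x ≫ h) :
    g = h :=
  obj_hom_ext fun T => (isCoproduct_tensorFreeι (Y.obj (op T)) ((P.obj T).obj m)).hom_ext fun x =>
    (Category.assoc _ _ _).symm.trans ((hgh T x).trans (Category.assoc _ _ _))

lemma exists_element_desc (φ : ∀ T : Necklace, (P.obj T).obj m → (Y.obj (op T) ⟶ Z))
    (hφ : ∀ {T U : Necklace} (f : T ⟶ U) (x : (P.obj T).obj m),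
      Y.map f.op ≫ φ T x = φ U ((P.map f).app m x)) :
    ∃ d : (weightedColimit Y (freeSimplicial P)).obj m ⟶ Z,
      ∀ (T : Necklace) (x : (P.obj T).obj m), elementι Y P x ≫ d = φ T x := by
  choose ψ hψ using fun T : Necklace =>
    (isCoproduct_tensorFreeι (Y.obj (op T)) ((P.obj T).obj m)).exists_desc (φ T)
  have ψ_nat {T U : Necklace} (f : T ⟶ U) :
      Y.map f.op ▷ (free V).obj ((P.obj T).obj m) ≫ ψ T =
        Y.obj (op U) ◁ (free V).map ((P.map f).app m) ≫ ψ U :=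
    (isCoproduct_tensorFreeι (Y.obj (op U)) ((P.obj T).obj m)).hom_ext fun x => by
      rw [← Category.assoc, ← Category.assoc, tensorFreeι_whiskerRight,
        tensorFreeι_whiskerLeft_map, Category.assoc, hψ, hψ, hφ]
  obtain ⟨d, hd⟩ := exists_obj_desc (G := freeSimplicial P) ψ ψ_nat
  exact ⟨d, fun T x => (Category.assoc _ _ _).trans ((_ ≫= hd T).trans (hψ T x))⟩

variable (Y P m)

/-- The morphisms `elementι` as a cocone over the category of `m`-simplices of the simplicial sets
`P_T`. -/
def elementsCocone : Cocone ((CategoryOfElements.π (P ⋙ (evaluation _ _).obj m)).op ⋙ Y) where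
  pt := (weightedColimit Y (freeSimplicial P)).obj m
  ι :=
    { app x := elementι Y P (T := x.unop.1) x.unop.2
      naturality := by
        rintro ⟨U, y⟩ ⟨T, x⟩ ⟨(f : T ⟶ U), (hf : (P.map f).app m x = y)⟩
        subst hf
        exact (map_elementι Y P f x).trans (Category.comp_id _).symm }

lemma nonempty_isColimit_elementsCocone : Nonempty (IsColimit (elementsCocone Y P m)) := by
  choose d hd using fun s : Cocone ((CategoryOfElements.π (P ⋙ (evaluation _ _).obj m)).op ⋙ Y) =>
    exists_element_desc (fun T x => s.ι.app (op ⟨T, x⟩)) fun {T U} f x =>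
      let p : (P ⋙ (evaluation _ _).obj m).Elements := ⟨T, x⟩
      let q : (P ⋙ (evaluation _ _).obj m).Elements := ⟨U, (P.map f).app m x⟩
      s.w (CategoryOfElements.homMk p q f rfl).op
  exact ⟨⟨d, fun s x => hd s _ _, fun s k hk => element_hom_ext fun T x =>
    (hk (op ⟨T, x⟩)).trans (hd s T x).symm⟩⟩

end Free

end weightedColimit

/-! ### Simplices of the categorification -/

namespace TemplicialObject.NonDegenerate

variable {V : Type u} [Category.{v} V] [MonoidalCategory V] [SymmetricCategory V]
  [MonoidalClosed V] [HasColimits V] {S : Type v} {X : TemplicialObject V S} (N : X.NonDegenerate)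
  (a b : S)

lemma isFreeOn_nec : IsFreeOn ((wideSubcategoryInclusion activeSurjective).op ⋙ X.nec a b)
    fun T => (N.inclNecklace T.obj).app a b := fun T =>
  have : HasColimitsOfSize.{0, 0} V := inferInstance
  VQuiv.isCoproduct_app (N.isFreeOn_necklaceFunctor T) a b

/-- The canonical morphism from `X_T^nd(a, b)` to the `n`-simplices of the categorification at a
flanked flag on `T`. -/
def flankedι (n : ℕ) (F : FlankedFlag n) :
    (N.ndNecklace F.necklace).obj a b ⟶ (X.categorification a b).obj (op ⦋n⦌) :=
  (N.inclNecklace F.necklace).app a b ≫ weightedColimit.elementι (X.nec a b) flags F.flag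

end TemplicialObject.NonDegenerate

end Templicial

end

theorem mainTheorem7_general {V : Type u} [Category.{v} V] [MonoidalCategory V]
    [SymmetricCategory V] [MonoidalClosed V] [HasColimits V] {S : Type v}
    {X : Templicial.TemplicialObject V S} (N : X.NonDegenerate) (n : ℕ) (a b : S) :
    Templicial.IsCoproduct (N.flankedι a b n) := by
  obtain ⟨h⟩ := Templicial.weightedColimit.nonempty_isColimit_elementsCocone (X.nec a b)
    Templicial.Necklace.flags (op (SimplexCategory.mk n))
  have h_flanked := (Functor.Final.isColimitWhiskerEquiv
    (Templicial.FlankedFlag.inclusion n).op _).symm h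
  have h_free := (N.isFreeOn_nec a b).comp_op
    (Templicial.FlankedFlag.isDiscreteOpfibration_toNecklace (n := n))
  exact h_free.isCoproduct_isColimit h_flanked

theorem mainTheorem7 {V : Type u} [Category.{v} V] [MonoidalCategory V] [SymmetricCategory V]
    [MonoidalClosed V] [HasLimits V] [HasColimits V] {S : Type v}
    (X : Templicial.TemplicialObject V S) (N : X.NonDegenerate) (n : ℕ) (a b : S) :
    Nonempty ((X.categorification a b).obj (op (SimplexCategory.mk n)) ≅
      ∐ fun T : Templicial.FlankedFlag n => (N.ndNecklace T.necklace).obj a b) :=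
  have : HasColimitsOfSize.{0, 0} V := inferInstance
  ⟨(mainTheorem7_general N n a b).some.coconePointUniqueUpToIso (coproductIsCoproduct _)⟩
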